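/- For $m\in\mathbb R^2$ and $r\in\mathbb R$ let $h_{m,r}:\mathbb R^2\to\{0,1\}$ be the indicator function of $\{x:|x-m|\le r\}$, and for $v=(m_1,r_1,\dots,m_n,r_n)\in\mathbb R^{3n}$ ($n\ge 0$) let $H_n(v):=\sum_{i=1}^n h_{m_i,r_i}|_{S^1}$, a function from the unit circle $S^1\subset\mathbb R^2$ to $\mathbb N=\{0,1,2,\dots\}$. For a function $g:S^1\to\mathbb N$ with finitely many discontinuities let $\mathrm{seq}(g)$ be the list of values of $g$ on the arcs between consecutive discontinuity points, in counterclockwise order, up to cyclic shifts (the one-term list consisting of the value of $g$ if $g$ is constant). Call $H_n(v)$ robust if there is $\bar\varepsilon>0$ such that $\mathrm{seq}(H_n(v+\varepsilon u))=\mathrm{seq}(H_n(v))$ for all $\varepsilon\in(0,\bar\varepsilon)$ and all $u\in\mathbb R^{3n}$ with Euclidean norm $|u|=1$. Let $f:S^1\to\mathbb N$ have finitely many discontinuities, and let $\bar f$ be the class of all functions $S^1\to\mathbb N$ that differ from $f$ at only finitely many points. Let $\langle\bar f\rangle\in\bar f$ be the canonical representative $\langle\bar f\rangle(x):=\max(f(x^+),f(x^-))$,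 where $f(x^\pm)$ are the one-sided limits along $S^1$, and put $$\bar f^*:=\max_{S^1}\langle\bar f\rangle,\qquad \bar f_*:=\min_{S^1}\langle\bar f\rangle,\qquad \tau:=\sum_{k=\bar f_*+1}^{\bar f^*}\bigl(\#\{\text{connected components of }\langle\bar f\rangle^{-1}([k,\infty))\}-1\bigr).$$ **Proposition.** Suppose that some robust $H_n(v)\in\bar f$ exists and that $\bar f_*\ge\tau$. Then there are exactly $(\bar f^*-\bar f_*+\tau)!$ distinct robust decompositions $H_n(v)\in\bar f$ (over all $n$ and $v$), where a decomposition is regarded as the multiset of the restrictions $h_{m_i,r_i}|_{S^1}$ that are not identically $0$; that is, the order of the signals is irrelevant, signals vanishing on $S^1$ are ignored, and data $(m_i,r_i)$ giving the same function on $S^1$ are not distinguished. -/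

import Mathlib

/-! The plane is `ℂ` (Euclidean norm), `S¹` is `Circle`. One signal is given by its centre and
radius `(m, r) : ℂ × ℝ`; a data vector in `ℝ^{3n}` is a map `Fin n → ℂ × ℝ`. -/

namespace CircleDecomp

/-- The signal function on the plane: the indicator of the closed disk with centre `p.1` and
radius `p.2`. -/
noncomputable def signal (p : ℂ × ℝ) (x : ℂ) : ℕ :=
  if ‖x - p.1‖ ≤ p.2 then 1 else 0

/-- The restriction of a signal function to the unit circle. -/
noncomputable def circleSignal (p : ℂ × ℝ) (x : Circle) : ℕ :=
  signal p (x : ℂ)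

/-- `H_n(v)`: the sum of the `n` signal functions, on the circle. -/
noncomputable def totalSignal {n : ℕ} (v : Fin n → ℂ × ℝ) (x : Circle) : ℕ :=
  ∑ i, circleSignal (v i) x

/-- Piecewise constant functions on the circle: only finitely many discontinuities
(`ℕ` is discrete, so such a function is constant between consecutive discontinuities). -/
def PiecewiseConst (f : Circle → ℕ) : Prop :=
  {x : Circle | ¬ ContinuousAt f x}.Finite

/-- The class `f̄` of all functions that disagree with `f` at only finitely many points. -/
def modFinite (f : Circle → ℕ) : Set (Circle → ℕ) :=
  {g | {x : Circle | g x ≠ f x}.Finite}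

/-- The angles in `[0, 2π)` of the discontinuity points of `f`. -/
def discAngles (f : Circle → ℕ) : Set ℝ :=
  {t | t ∈ Set.Ico 0 (2 * Real.pi) ∧ ¬ ContinuousAt f (Circle.exp t)}

/-- The values of `f` at the midpoints of the arcs between cyclically consecutive angles of an
increasing list of angles in `[0, 2π)`; for the empty list, the single value `f 1`. -/
noncomputable def arcValues (f : Circle → ℕ) : List ℝ → List ℕ
  | [] => [f 1]
  | a :: l =>
    List.zipWith (fun s t => f (Circle.exp ((s + t) / 2))) (a :: l) (l ++ [a + 2 * Real.pi])

open Classical in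
/-- The sequence representation of a piecewise constant function: the values between consecutive
discontinuity points in counterclockwise order, as a list up to cyclic shifts
(a dummy value if there are infinitely many discontinuities). -/
noncomputable def seqRep (f : Circle → ℕ) : Cycle ℕ :=
  if h : (discAngles f).Finite then
    ((arcValues f (h.toFinset.sort (· ≤ ·)) : List ℕ) : Cycle ℕ)
  else Cycle.nil

/-- Robustness of `H_n(v)`: all sufficiently small perturbations of the data, in the Euclidean norm
of `ℝ^{3n}`, leave the sequence representation unchanged. -/
def Robust {n : ℕ} (v : Fin n → ℂ × ℝ) : Prop :=
  ∃ δ : ℝ, 0 < δ ∧ ∀ ε ∈ Set.Ioo (0 : ℝ) δ, ∀ u : Fin n → ℂ × ℝ,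
    Real.sqrt (∑ i, (‖(u i).1‖ ^ 2 + (u i).2 ^ 2)) = 1 →
      seqRep (totalSignal (v + ε • u)) = seqRep (totalSignal v)

/-- The counterclockwise limit `f(x⁺)`. -/
noncomputable def limPlus (f : Circle → ℕ) (x : Circle) : ℕ :=
  Function.rightLim (fun t : ℝ => f (x * Circle.exp t)) 0

/-- The clockwise limit `f(x⁻)`. -/
noncomputable def limMinus (f : Circle → ℕ) (x : Circle) : ℕ :=
  Function.leftLim (fun t : ℝ => f (x * Circle.exp t)) 0

/-- The canonical representative `⟨f̄⟩`: the properly upper semicontinuous function in the class of a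
piecewise constant `f`. -/
noncomputable def canon (f : Circle → ℕ) (x : Circle) : ℕ :=
  max (limPlus f x) (limMinus f x)

/-- `f̄^*`, the maximum of the canonical representative (which takes finitely many values). -/
noncomputable def upper (f : Circle → ℕ) : ℕ := sSup (Set.range (canon f))

/-- `f̄_*`, the minimum of the canonical representative. -/
noncomputable def lower (f : Circle → ℕ) : ℕ := sInf (Set.range (canon f))

/-- `τ(f̄)`: the sum over the levels `f̄_* < k ≤ f̄^*` of the number of connected components of the
(nonempty) set where the canonical representative is at least `k`, minus one. -/
noncomputable def tau (f : Circle → ℕ) : ℕ :=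
  ∑ k ∈ Finset.Icc (lower f + 1) (upper f),
    (Nat.card (ConnectedComponents {x : Circle // k ≤ canon f x}) - 1)

open Classical in
/-- The decomposition, as a collection of signals seen on the circle: the multiset of the
restrictions to the circle of the signal functions, without the inactive ones (those that vanish
identically on the circle). -/
noncomputable def activeSignals {n : ℕ} (v : Fin n → ℂ × ℝ) : Multiset (Circle → ℕ) :=
  (Finset.univ.val.map fun i => circleSignal (v i)).filter (fun g => g ≠ 0)

/-- The robust decompositions in `f̄`, two of them being identified when they consist of the same
active signals on the circle with the same multiplicities. -/
def robustDecomps (f : Circle → ℕ) : Set (Multiset (Circle → ℕ)) :=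
  {M | ∃ (n : ℕ) (v : Fin n → ℂ × ℝ),
    totalSignal v ∈ modFinite f ∧ Robust v ∧ activeSignals v = M}

end CircleDecomp

open Filter Topology

namespace CircleDecomp

/-! A disk whose boundary crosses the unit circle at two points cuts out a closed arc; any other
signal restricts to `0`, to `1`, or to the indicator of a tangency point. Robustness rules out
tangency points and shared endpoints: enlarging one radius to a generic nearby value gives that
signal two endpoints shared with no other signal, and the length of `seqRep` must not change
(`Robust.one_lt_ncard_ends`). Conversely, endpoints of stable signals move continuously, so disjoint
endpoints keep their cyclic order (`robust_of_stable`).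

Hence a robust decomposition consists of arcs with pairwise distinct endpoints and `c` full circles
(`Robust.exists_arcs`, `exists_robust_of_arcs`). Its arcs start exactly at the upward jumps of `f`
and end exactly at the downward ones, so it is a bijection `σ : upJumps f ≃ downJumps f` together
with `c` (`Robust.exists_matching`). Distinct bijections give distinct multisets
(`matchingSignals_injective`).

Re-matching the endpoints changes the sum of the arcs only by a constant (`sum_arc_add_sum_arc`), so
`σ` determines `c`, and `σ` is admissible iff this `c` is not negative. Let `N` be the number of
upward jumps. All jumps have height one, and the jumps up across level `k` correspond to the
components of the superlevel set, so `N = upper f - lower f + tau f` (`ncard_upJumps_add_lower`). At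
a maximum point the `N` arcs sum to at most `N`, hence at a minimum point to at most `tau f ≤ lower
f`. So all `N!` bijections are admissible. -/

/-! ### Angular coordinates on the circle -/

open Circle in
lemma angleDiff_mul_exp (a : Circle) {s : ℝ} (h0 : 0 ≤ s) (h1 : s < 2 * Real.pi) :
    angleDiff a (a * Circle.exp s) = s := by
  have h := exp_angleDiff_mul (x := a) (y := a * Circle.exp s)
  rw [mul_comm, mul_right_inj] at h
  exact Circle.exp_injOn_Ico (a := 0) (b := 2 * Real.pi) (by simp)
    ⟨angleDiff_nonneg _ _, angleDiff_lt_two_pi _ _⟩ ⟨h0, h1⟩ h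

lemma mul_exp_angleDiff (a x : Circle) : a * Circle.exp (Circle.angleDiff a x) = x := by
  rw [mul_comm]; exact Circle.exp_angleDiff_mul

lemma angleDiff_self (a : Circle) : Circle.angleDiff a a = 0 := by
  simpa using angleDiff_mul_exp a le_rfl Real.two_pi_pos

lemma angleDiff_inj {a x y : Circle} : Circle.angleDiff a x = Circle.angleDiff a y ↔ x = y := by
  refine ⟨fun h => ?_, fun h => h ▸ rfl⟩
  rw [← mul_exp_angleDiff a x, h, mul_exp_angleDiff]

lemma angleDiff_eq_zero {a x : Circle} : Circle.angleDiff a x = 0 ↔ x = a := by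
  rw [← angleDiff_self a, angleDiff_inj]

/-! ### One-sided values -/

/-- `h` is constant, with value `l`, on a short arc ending at `x`, and constant, with value `r`,
on a short arc starting at `x`. -/
def HasSides (h : Circle → ℕ) (x : Circle) (l r : ℕ) : Prop :=
  (∀ᶠ t in 𝓝[<] (0 : ℝ), h (x * Circle.exp t) = l) ∧
    ∀ᶠ t in 𝓝[>] (0 : ℝ), h (x * Circle.exp t) = r

namespace HasSides

variable {h h' : Circle → ℕ} {x : Circle} {l r l' r' : ℕ}

lemma limPlus_eq (H : HasSides h x l r) : limPlus h x = r :=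
  rightLim_eq_of_tendsto
    (tendsto_nhds_of_eventually_eq H.2)

lemma limMinus_eq (H : HasSides h x l r) : limMinus h x = l :=
  leftLim_eq_of_tendsto
    (tendsto_nhds_of_eventually_eq H.1)

lemma const (c : ℕ) (x : Circle) : HasSides (fun _ => c) x c c := by simp [HasSides]

lemma sum {ι : Type*} {s : Finset ι} {h : ι → Circle → ℕ} {x : Circle} {l r : ι → ℕ}
    (H : ∀ i ∈ s, HasSides (h i) x (l i) (r i)) :
    HasSides (fun y => ∑ i ∈ s, h i y) x (∑ i ∈ s, l i) (∑ i ∈ s, r i) := by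
  constructor
  · filter_upwards [(Finset.eventually_all s).2 fun i hi => (H i hi).1] with t ht
    exact Finset.sum_congr rfl ht
  · filter_upwards [(Finset.eventually_all s).2 fun i hi => (H i hi).2] with t ht
    exact Finset.sum_congr rfl ht

end HasSides

lemma nhds_eq_map_exp (x : Circle) : 𝓝 x = map (fun t : ℝ => x * Circle.exp t) (𝓝 0) := by
  have h1 : map Circle.exp (𝓝 0) = 𝓝 1 := by
    rw [isLocalHomeomorph_circleExp.map_nhds_eq, Circle.exp_zero]
  have h2 : map (fun y => x * y) (𝓝 (1 : Circle)) = 𝓝 x := by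
    simpa only [Homeomorph.coe_mulLeft, mul_one] using (Homeomorph.mulLeft x).map_nhds_eq 1
  rw [← h2, ← h1, map_map]; rfl

lemma eventually_nhds_circle {P : Circle → Prop} {x : Circle} :
    (∀ᶠ y in 𝓝 x, P y) ↔ P x ∧ (∀ᶠ t in 𝓝[<] (0 : ℝ), P (x * Circle.exp t)) ∧
      ∀ᶠ t in 𝓝[>] (0 : ℝ), P (x * Circle.exp t) := by
  rw [nhds_eq_map_exp, eventually_map, ← nhdsNE_sup_pure, ← nhdsLT_sup_nhdsGT, eventually_sup,
    eventually_sup]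
  simp [and_comm]

lemma continuousAt_iff_eventually {h : Circle → ℕ} {x : Circle} :
    ContinuousAt h x ↔ ∀ᶠ y in 𝓝 x, h y = h x := by
  rw [ContinuousAt, nhds_discrete ℕ, tendsto_pure]

lemma HasSides.continuousAt_iff {h : Circle → ℕ} {x : Circle} {l r : ℕ} (H : HasSides h x l r) :
    ContinuousAt h x ↔ l = h x ∧ r = h x := by
  rw [continuousAt_iff_eventually, eventually_nhds_circle]
  constructor
  · rintro ⟨-, h1, h2⟩
    obtain ⟨t, ht⟩ := (h1.and H.1).exists
    obtain ⟨s, hs⟩ := (h2.and H.2).exists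
    exact ⟨ht.2.symm.trans ht.1, hs.2.symm.trans hs.1⟩
  · rintro ⟨rfl, h2⟩
    exact ⟨rfl, by rw [h2] at H; exact H⟩

lemma mul_exp_ne_self (x : Circle) {t : ℝ} (h0 : t ≠ 0) (h1 : -(2 * Real.pi) < t)
    (h2 : t < 2 * Real.pi) : x * Circle.exp t ≠ x := by
  intro h
  rw [mul_eq_left, Circle.exp_eq_one] at h
  obtain ⟨n, rfl⟩ := h
  have hpi := Real.two_pi_pos
  have h3 : (n : ℝ) < 1 := by nlinarith
  have h4 : (-1 : ℝ) < n := by nlinarith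
  have : n = 0 := by
    have h3' : n < 1 := by exact_mod_cast h3
    have h4' : -1 < n := by exact_mod_cast h4
    omega
  simp [this] at h0

/-- A finite set misses a punctured neighbourhood of `x`. This is what makes one-sided limits
invariants of the class `modFinite f`. -/
lemma HasSides.of_finite_ne {g f : Circle → ℕ} {x : Circle} {l r : ℕ} (H : HasSides g x l r)
    (hfin : {y | g y ≠ f y}.Finite) : HasSides f x l r := by
  have h1 : ∀ᶠ y in 𝓝 x, y ∉ {y | g y ≠ f y} \ {x} :=
    (hfin.subset Set.sdiff_subset).isClosed.isOpen_compl.mem_nhds (by simp)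
  rw [eventually_nhds_circle] at h1
  have hpi := Real.two_pi_pos
  constructor
  · filter_upwards [h1.2.1, H.1, Ioo_mem_nhdsLT (neg_lt_zero.2 hpi)] with t ht1 ht2 ht3
    by_contra hne
    exact ht1 ⟨fun h => hne (h ▸ ht2), mul_exp_ne_self x ht3.2.ne ht3.1 (ht3.2.trans hpi)⟩
  · filter_upwards [h1.2.2, H.2, Ioo_mem_nhdsGT hpi] with t ht1 ht2 ht3
    by_contra hne
    exact ht1 ⟨fun h => hne (h ▸ ht2),
      mul_exp_ne_self x ht3.1.ne' ((neg_lt_zero.2 hpi).trans ht3.1) ht3.2⟩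

/-! ### Indicators of closed arcs -/

/-- The indicator function of the closed arc that runs counterclockwise from `a` to `b`. -/
noncomputable def arc (a b x : Circle) : ℕ :=
  if Circle.angleDiff a x ≤ Circle.angleDiff a b then 1 else 0

lemma arc_le_one (a b x : Circle) : arc a b x ≤ 1 := by
  unfold arc; split_ifs <;> simp

lemma arc_mul_exp (a b : Circle) {s : ℝ} (h0 : 0 ≤ s) (h1 : s < 2 * Real.pi) :
    arc a b (a * Circle.exp s) = if s ≤ Circle.angleDiff a b then 1 else 0 := by
  rw [arc, angleDiff_mul_exp a h0 h1]

/-- Change of base point: the difference of the two angles seen from `x₀`, plus a full turn if the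
path from `a` to `x` passes `x₀`. -/
lemma angleDiff_eq_of_base (x₀ a x : Circle) : Circle.angleDiff a x =
    if Circle.angleDiff x₀ a ≤ Circle.angleDiff x₀ x then
      Circle.angleDiff x₀ x - Circle.angleDiff x₀ a
    else 2 * Real.pi + Circle.angleDiff x₀ x - Circle.angleDiff x₀ a := by
  have h1 := Circle.angleDiff_nonneg x₀ a
  have h2 := Circle.angleDiff_lt_two_pi x₀ a
  have h3 := Circle.angleDiff_nonneg x₀ x
  have h4 := Circle.angleDiff_lt_two_pi x₀ x
  have key : x = a * Circle.exp (Circle.angleDiff x₀ x - Circle.angleDiff x₀ a) := by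
    conv_rhs => rw [← mul_exp_angleDiff x₀ a, mul_assoc, ← Circle.exp_add]
    rw [mul_exp_angleDiff, add_sub_cancel, mul_exp_angleDiff]
  split_ifs with h
  · conv_lhs => rw [key]
    exact angleDiff_mul_exp _ (by linarith) (by linarith)
  · have key' : x = a * Circle.exp
        (2 * Real.pi + Circle.angleDiff x₀ x - Circle.angleDiff x₀ a) := by
      rw [add_sub_assoc, Circle.exp_add]; simpa using key
    conv_lhs => rw [key']
    exact angleDiff_mul_exp _ (by linarith) (by linarith)

/-- The arcs from `a` to `b` for different `b` differ only through terms that depend on `a` or `b`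
alone, up to a constant. -/
lemma arc_add (x₀ a b x : Circle) :
    arc a b x + (if Circle.angleDiff x₀ b < Circle.angleDiff x₀ x then 1 else 0) =
      (if Circle.angleDiff x₀ a ≤ Circle.angleDiff x₀ x then 1 else 0) +
        if Circle.angleDiff x₀ b < Circle.angleDiff x₀ a then 1 else 0 := by
  have h1 := Circle.angleDiff_nonneg x₀ a
  have h2 := Circle.angleDiff_lt_two_pi x₀ a
  have h3 := Circle.angleDiff_nonneg x₀ x
  have h4 := Circle.angleDiff_lt_two_pi x₀ x
  have h5 := Circle.angleDiff_nonneg x₀ b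
  have h6 := Circle.angleDiff_lt_two_pi x₀ b
  rw [arc, angleDiff_eq_of_base x₀ a x, angleDiff_eq_of_base x₀ a b]
  grind

lemma hasSides_arc (a b x : Circle) : HasSides (arc a b) x
    (if 0 < Circle.angleDiff a x ∧ Circle.angleDiff a x ≤ Circle.angleDiff a b then 1 else 0)
    (if Circle.angleDiff a x < Circle.angleDiff a b then 1 else 0) := by
  have h1 := Circle.angleDiff_nonneg a x
  have h2 := Circle.angleDiff_lt_two_pi a x
  have h3 := Circle.angleDiff_nonneg a b
  have h4 := Circle.angleDiff_lt_two_pi a b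
  have key : ∀ t, x * Circle.exp t = a * Circle.exp (Circle.angleDiff a x + t) := by
    intro t; rw [Circle.exp_add, ← mul_assoc, mul_exp_angleDiff]
  constructor
  · rcases h1.eq_or_lt with h0 | h0
    · filter_upwards [Ioo_mem_nhdsLT (sub_neg.2 h4)] with t ht
      have : x * Circle.exp t = a * Circle.exp (2 * Real.pi + t) := by
        rw [key, ← h0, Circle.exp_add _ t]; simp
      rw [this, arc_mul_exp a b (by linarith [ht.1]) (by linarith [ht.2]), if_neg, if_neg]
      · simp [← h0]
      · linarith [ht.1]
    · rcases le_or_gt (Circle.angleDiff a x) (Circle.angleDiff a b) with h5 | h5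
      · filter_upwards [Ioo_mem_nhdsLT (neg_lt_zero.2 h0)] with t ht
        rw [key, arc_mul_exp a b (by linarith [ht.1]) (by linarith [ht.2]), if_pos, if_pos]
        · exact ⟨h0, h5⟩
        · linarith [ht.2]
      · filter_upwards [Ioo_mem_nhdsLT (sub_neg.2 h5)] with t ht
        rw [key, arc_mul_exp a b (by linarith [ht.1]) (by linarith [ht.2]), if_neg, if_neg]
        · exact fun h => h5.not_ge h.2
        · linarith [ht.1]
  · rcases lt_or_ge (Circle.angleDiff a x) (Circle.angleDiff a b) with h5 | h5
    · filter_upwards [Ioo_mem_nhdsGT (sub_pos.2 h5)] with t ht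
      rw [key, arc_mul_exp a b (by linarith [ht.1]) (by linarith [ht.2]), if_pos, if_pos h5]
      linarith [ht.2]
    · filter_upwards [Ioo_mem_nhdsGT (sub_pos.2 h2)] with t ht
      rw [key, arc_mul_exp a b (by linarith [ht.1]) (by linarith [ht.2]), if_neg, if_neg h5.not_gt]
      linarith [ht.1]

lemma not_continuousAt_arc_iff {a b : Circle} (hab : a ≠ b) {x : Circle} :
    ¬ ContinuousAt (arc a b) x ↔ x = a ∨ x = b := by
  rw [(hasSides_arc a b x).continuousAt_iff, ← angleDiff_eq_zero,
    ← angleDiff_inj (a := a) (x := x)]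
  have h1 := Circle.angleDiff_nonneg a x
  have h3 := Circle.angleDiff_pos hab
  rw [arc]
  grind

/-! ### Reading off the sequence representation -/

lemma seqRep_eq_arcValues {F : Circle → ℕ} {l : List ℝ} (hs : l.Pairwise (· < ·))
    (h0 : ∀ t ∈ l, 0 ≤ t ∧ t < 2 * Real.pi)
    (hd : ∀ x, ¬ ContinuousAt F x ↔ ∃ t ∈ l, Circle.exp t = x) :
    seqRep F = (arcValues F l : Cycle ℕ) := by
  classical
  have hset : discAngles F = ↑l.toFinset := by
    ext t
    simp only [discAngles, Set.mem_ofPred_eq, hd, List.coe_toFinset]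
    constructor
    · rintro ⟨ht, s, hsl, hst⟩
      rwa [← Circle.exp_injOn_Ico (a := 0) (b := 2 * Real.pi) (by simp) (h0 s hsl) ht hst]
    · exact fun ht => ⟨h0 t ht, t, ht, rfl⟩
  have hfin : (discAngles F).Finite := hset ▸ l.toFinset.finite_toSet
  have hto : hfin.toFinset = l.toFinset := by
    apply Finset.coe_injective; rw [hfin.coe_toFinset, hset]
  rw [seqRep, dif_pos hfin, hto]
  congr 2
  exact (List.toFinset_sort (· ≤ ·) hs.nodup).2 (hs.imp le_of_lt)

/-- Raising the smallest lift by a full turn only rotates the list of values. -/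
lemma arcValues_rotate (F : Circle → ℕ) (a : ℝ) (l : List ℝ) :
    arcValues F (l ++ [a + 2 * Real.pi]) ~r arcValues F (a :: l) := by
  have hF : ∀ s t : ℝ, F (Circle.exp ((s + 2 * Real.pi + (t + 2 * Real.pi)) / 2)) =
      F (Circle.exp ((s + t) / 2)) := by
    intro s t
    rw [show (s + 2 * Real.pi + (t + 2 * Real.pi)) / 2 = (s + t) / 2 + 2 * Real.pi by ring,
      Circle.exp_add_two_pi]
  cases l with
  | nil => simp [arcValues, hF, List.IsRotated.refl]
  | cons b l =>
    simp only [arcValues, List.cons_append, List.append_assoc, List.zipWith_cons_cons]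
    rw [show b :: (l ++ [a + 2 * Real.pi]) = (b :: l) ++ [a + 2 * Real.pi] from rfl,
      show l ++ (a + 2 * Real.pi) :: ([] ++ [b + 2 * Real.pi]) =
        (l ++ [a + 2 * Real.pi]) ++ [b + 2 * Real.pi] by simp, List.zipWith_append (by simp)]
    simp only [List.zipWith_cons_cons, List.zipWith_nil_left, hF]
    exact (List.isRotated_append (l := [_])).symm

/-- The sequence representation can be read off from any increasing list of lifts of the
discontinuities. -/
lemma seqRep_eq_of_lifts {F : Circle → ℕ} : ∀ {l : List ℝ}, l.Pairwise (· < ·) →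
    (∀ t ∈ l, -(2 * Real.pi) ≤ t ∧ t < 2 * Real.pi) →
    (∀ s ∈ l, ∀ t ∈ l, t < s + 2 * Real.pi) →
    (∀ x, ¬ ContinuousAt F x ↔ ∃ t ∈ l, Circle.exp t = x) →
    seqRep F = (arcValues F l : Cycle ℕ) := by
  intro l
  -- Each step raises the first, negative lift by `2π`; once none is negative, the list is the
  -- sorted list of `discAngles`.
  induction hn : l.countP (· < 0) generalizing l with
  | zero =>
    intro hs h0 _ hd
    refine seqRep_eq_arcValues hs (fun t ht => ⟨?_, (h0 t ht).2⟩) hd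
    simpa using List.countP_eq_zero.1 hn t ht
  | succ n ih =>
    intro hs h0 hw hd
    cases l with
    | nil => simp at hn
    | cons a l =>
      have ha : a < 0 := by
        by_contra ha
        have : ∀ t ∈ a :: l, ¬ t < 0 := by
          intro t ht
          rcases List.mem_cons.1 ht with rfl | ht
          · exact ha
          · exact fun h => ha ((List.rel_of_pairwise_cons hs ht).trans h)
        rw [List.countP_eq_zero.2 (by simpa using this)] at hn
        omega
      have hpi := Real.two_pi_pos
      have ha2 := (h0 a (by simp)).1
      rw [← (Cycle.coe_eq_coe.2 (arcValues_rotate F a l))]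
      refine ih ?_ ?_ ?_ ?_ ?_
      · have h1 : ¬ (a + 2 * Real.pi < 0) := by linarith
        rw [List.countP_cons_of_pos (by simpa using ha)] at hn
        rw [List.countP_append, List.countP_cons_of_neg (by simpa using h1)]
        simpa using hn
      · rw [List.pairwise_append]
        refine ⟨hs.of_cons, by simp, fun s hs t ht => ?_⟩
        rw [List.mem_singleton.1 ht]
        exact hw a (by simp) s (by simp [hs])
      · intro t ht
        rcases List.mem_append.1 ht with ht | ht
        · exact h0 t (by simp [ht])
        · rw [List.mem_singleton.1 ht]; constructor <;> linarith
      · intro s hsl t ht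
        rcases List.mem_append.1 ht with ht | ht <;> rcases List.mem_append.1 hsl with hsl | hsl
        · exact hw s (by simp [hsl]) t (by simp [ht])
        · have := hw a (by simp) t (by simp [ht])
          rw [List.mem_singleton.1 hsl]; linarith
        · have := List.rel_of_pairwise_cons hs hsl
          rw [List.mem_singleton.1 ht]; linarith
        · rw [List.mem_singleton.1 ht, List.mem_singleton.1 hsl]; linarith
      · intro x
        rw [hd x]
        simp only [List.mem_cons, List.mem_append, List.not_mem_nil, or_false, or_and_right,
          exists_or, exists_eq_left, Circle.exp_add_two_pi]
        exact or_comm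

lemma ncard_discAngles (F : Circle → ℕ) :
    (discAngles F).ncard = {x | ¬ ContinuousAt F x}.ncard := by
  have : {x | ¬ ContinuousAt F x} = Circle.exp '' discAngles F := by
    ext x
    constructor
    · intro hx
      have h := mul_exp_angleDiff 1 x
      rw [one_mul] at h
      exact ⟨_, ⟨⟨Circle.angleDiff_nonneg 1 x, Circle.angleDiff_lt_two_pi 1 x⟩, by rwa [h]⟩, h⟩
    · rintro ⟨t, ht, rfl⟩; exact ht.2
  rw [this, Set.InjOn.ncard_image]
  exact (Circle.exp_injOn_Ico (a := 0) (b := 2 * Real.pi) (by simp)).mono fun t ht => ht.1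

lemma finite_discAngles {F : Circle → ℕ} (h : PiecewiseConst F) : (discAngles F).Finite := by
  refine Set.Finite.of_finite_image (f := Circle.exp) (h.subset ?_) ?_
  · rintro _ ⟨t, ht, rfl⟩; exact ht.2
  · exact (Circle.exp_injOn_Ico (a := 0) (b := 2 * Real.pi) (by simp)).mono fun t ht => ht.1

/-- The `max 1` reflects the one-term list of a constant function. Of `seqRep`, only this length is
used to derive consequences of robustness. -/
lemma length_seqRep {F : Circle → ℕ} (h : PiecewiseConst F) :
    (seqRep F).length = max 1 {x | ¬ ContinuousAt F x}.ncard := by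
  have hfin := finite_discAngles h
  rw [seqRep, dif_pos hfin, Cycle.length_coe, ← ncard_discAngles,
    Set.ncard_eq_toFinset_card _ hfin, ← Finset.length_sort (· ≤ ·)]
  cases hfin.toFinset.sort (· ≤ ·) with
  | nil => simp [arcValues]
  | cons a l => simp [arcValues]

/-- Midpoints of consecutive lifts are continuity points of `F`, so it suffices to compare values
under that assumption. Allowing arbitrary pairs `s`, `t` keeps adjacency out of the hypotheses. -/
lemma arcValues_map {F F' : Circle → ℕ} {l : List ℝ} (A : ℝ → ℝ) (hs : l.Pairwise (· < ·))
    (h0 : ∀ t ∈ l, 0 ≤ t ∧ t < 2 * Real.pi)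
    (hd : ∀ x, ¬ ContinuousAt F x ↔ ∃ t ∈ l, Circle.exp t = x)
    (hnil : l = [] → F' 1 = F 1)
    (h1 : ∀ s ∈ l, ∀ t ∈ l, ContinuousAt F (Circle.exp ((s + t) / 2)) →
      F' (Circle.exp ((A s + A t) / 2)) = F (Circle.exp ((s + t) / 2)))
    (h2 : ∀ s ∈ l, ∀ t ∈ l, ContinuousAt F (Circle.exp ((s + (t + 2 * Real.pi)) / 2)) →
      F' (Circle.exp ((A s + (A t + 2 * Real.pi)) / 2)) =
        F (Circle.exp ((s + (t + 2 * Real.pi)) / 2))) :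
    arcValues F' (l.map A) = arcValues F l := by
  cases l with
  | nil => simpa [arcValues] using hnil
  | cons a l =>
    have hpi := Real.two_pi_pos
    have hinj := Circle.exp_injOn_Ico (a := 0) (b := 2 * Real.pi) (by simp)
    rw [List.map_cons, arcValues, arcValues]
    apply List.ext_getElem (by simp)
    intro i hi hi'
    simp only [List.length_zipWith, List.length_cons, List.length_append, List.length_nil,
      zero_add, min_self] at hi'
    rw [List.getElem_zipWith, List.getElem_zipWith]
    simp only [← List.map_cons, List.getElem_map]
    have hmem : (a :: l)[i] ∈ a :: l := List.getElem_mem _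
    by_cases hil : i < l.length
    · have hmem' : l[i] ∈ a :: l := List.mem_cons_of_mem _ (List.getElem_mem _)
      rw [List.getElem_append_left (by simpa using hil), List.getElem_append_left hil,
        List.getElem_map]
      apply h1 _ hmem _ hmem'
      by_contra hc
      obtain ⟨t, ht, hte⟩ := (hd _).1 hc
      have hi1 : i + 1 < (a :: l).length := by simpa using hil
      have hlt : (a :: l)[i] < (a :: l)[i + 1] := List.pairwise_iff_getElem.1 hs _ _ _ _ (by omega)
      rw [List.getElem_cons_succ] at hlt
      have := hinj (h0 t ht) ⟨by linarith [(h0 _ hmem).1, (h0 _ hmem').1],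
        by linarith [(h0 _ hmem).2, (h0 _ hmem').2]⟩ hte
      obtain ⟨j, hj, rfl⟩ := List.getElem_of_mem ht
      rcases Nat.lt_or_ge i j with hij | hij
      · have : (a :: l)[i + 1] ≤ (a :: l)[j] := by
          rcases Nat.lt_or_ge (i + 1) j with hij' | hij'
          · exact (List.pairwise_iff_getElem.1 hs _ _ _ _ hij').le
          · have : i + 1 = j := by omega
            subst this; exact le_rfl
        rw [List.getElem_cons_succ] at this
        linarith
      · have : (a :: l)[j] ≤ (a :: l)[i] := by
          rcases Nat.lt_or_ge j i with hij' | hij'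
          · exact (List.pairwise_iff_getElem.1 hs _ _ _ _ hij').le
          · have : i = j := by omega
            subst this; exact le_rfl
        linarith
    · have hil : i = l.length := by omega
      subst hil
      rw [List.getElem_append_right (by simp), List.getElem_append_right (by simp)]
      simp only [List.length_map, Nat.sub_self, List.getElem_cons_zero]
      apply h2 _ hmem _ (by simp)
      by_contra hc
      obtain ⟨t, ht, hte⟩ := (hd _).1 hc
      have hta : a ≤ t := by
        rcases List.mem_cons.1 ht with rfl | ht
        · exact le_rfl
        · exact (List.rel_of_pairwise_cons hs ht).le
      have htl : t ≤ (a :: l)[l.length] := by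
        obtain ⟨j, hj, rfl⟩ := List.getElem_of_mem ht
        rcases Nat.lt_or_ge j l.length with hij' | hij'
        · exact (List.pairwise_iff_getElem.1 hs _ _ _ _ hij').le
        · have : j = l.length := by simp at hj; omega
          subst this; exact le_rfl
      have ha := h0 a (by simp)
      have hb := h0 _ hmem
      -- The midpoint of the arc across angle `0` may lie past `2π`; it is then brought back by a
      -- full turn.
      rcases lt_or_ge (((a :: l)[l.length] + (a + 2 * Real.pi)) / 2) (2 * Real.pi) with h | h
      · have := hinj (h0 t ht) ⟨by linarith, h⟩ hte
        linarith
      · rw [← Circle.exp_sub_two_pi (((a :: l)[l.length] + (a + 2 * Real.pi)) / 2)] at hte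
        have := hinj (h0 t ht) ⟨by linarith, by linarith⟩ hte
        linarith

/-! ### Disks and the arcs they cut out -/

lemma norm_exp_sub_sq (t ρ θ : ℝ) :
    ‖((Circle.exp t : Circle) : ℂ) - ρ * (Circle.exp θ : Circle)‖ ^ 2 =
      1 + ρ ^ 2 - 2 * ρ * Real.cos (t - θ) := by
  rw [← Complex.normSq_eq_norm_sq, Complex.normSq_apply, Circle.coe_exp, Circle.coe_exp]
  simp only [Complex.sub_re, Complex.sub_im, Complex.re_ofReal_mul, Complex.im_ofReal_mul,
    Complex.exp_ofReal_mul_I_re, Complex.exp_ofReal_mul_I_im, Real.cos_sub]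
  nlinarith [Real.sin_sq_add_cos_sq t, Real.sin_sq_add_cos_sq θ]

lemma cos_le_cos_sub_iff {s w : ℝ} (h0 : 0 ≤ s) (h1 : s < 2 * Real.pi) (hw0 : 0 < w)
    (hw1 : w < Real.pi) : Real.cos w ≤ Real.cos (s - w) ↔ s ≤ 2 * w := by
  rcases le_or_gt (s - w) Real.pi with h | h
  · rw [← Real.cos_abs (s - w), Real.strictAntiOn_cos.le_iff_ge
      ⟨hw0.le, hw1.le⟩ ⟨abs_nonneg _, abs_le.2 ⟨by linarith, h⟩⟩, abs_le]
    constructor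
    · intro h; linarith [h.2]
    · intro h; constructor <;> linarith
  · have h2 : Real.cos (s - w) = Real.cos (2 * Real.pi - (s - w)) := (Real.cos_two_pi_sub _).symm
    rw [h2, Real.strictAntiOn_cos.le_iff_ge ⟨hw0.le, hw1.le⟩ ⟨by linarith, by linarith⟩]
    constructor <;> intro h <;> linarith

section Polar

variable {ρ θ w r : ℝ}

lemma exp_sub_mul_exp_two_mul (θ w : ℝ) :
    Circle.exp (θ - w) * Circle.exp (2 * w) = Circle.exp (θ + w) := by
  rw [← Circle.exp_add]; congr 1; ring

lemma exp_sub_ne_exp_add (θ : ℝ) (hw0 : 0 < w) (hw1 : w < Real.pi) :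
    Circle.exp (θ - w) ≠ Circle.exp (θ + w) := by
  rw [← exp_sub_mul_exp_two_mul]
  exact (mul_exp_ne_self _ (by linarith) (by linarith) (by linarith)).symm

/-- By the law of cosines, the point at angle `t` lies in the disk iff `cos w ≤ cos (t - θ)`, that
is, iff it is within angle `w` of the direction of the centre. -/
lemma circleSignal_polar (hρ : 0 < ρ) (hr : 0 ≤ r) (hw0 : 0 < w) (hw1 : w < Real.pi)
    (h : 1 + ρ ^ 2 - r ^ 2 = 2 * ρ * Real.cos w) :
    circleSignal (ρ * (Circle.exp θ : Circle), r) =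
      arc (Circle.exp (θ - w)) (Circle.exp (θ + w)) := by
  funext x
  obtain ⟨s, hs0, hs1, rfl⟩ : ∃ s : ℝ, 0 ≤ s ∧ s < 2 * Real.pi ∧
      x = Circle.exp (θ - w) * Circle.exp s :=
    ⟨_, Circle.angleDiff_nonneg _ _, Circle.angleDiff_lt_two_pi _ _,
      (mul_exp_angleDiff (Circle.exp (θ - w)) x).symm⟩
  rw [arc_mul_exp _ _ hs0 hs1, ← exp_sub_mul_exp_two_mul,
    angleDiff_mul_exp _ (by linarith) (by linarith), circleSignal, signal, ← Circle.exp_add]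
  refine if_congr ?_ rfl rfl
  rw [← cos_le_cos_sub_iff hs0 hs1 hw0 hw1, ← sq_le_sq₀ (norm_nonneg _) hr, norm_exp_sub_sq,
    show θ - w + s - θ = s - w by ring, ← mul_le_mul_iff_right₀ (b := Real.cos w) (show 0 < 2 * ρ by linarith)]
  constructor <;> intro h <;> linarith

/-- No bound on `w` is needed, so that `w = 0` covers tangency. -/
lemma eq_of_norm_sub_eq (hρ : 0 < ρ) (h : 1 + ρ ^ 2 - r ^ 2 = 2 * ρ * Real.cos w) {x : Circle}
    (hx : ‖(x : ℂ) - ρ * (Circle.exp θ : Circle)‖ = r) :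
    x = Circle.exp (θ - w) ∨ x = Circle.exp (θ + w) := by
  obtain ⟨t, rfl⟩ := Circle.exp_surjective x
  have h1 := norm_exp_sub_sq t ρ θ
  rw [hx] at h1
  have h2 : Real.cos w = Real.cos (t - θ) := by
    have : 2 * ρ * Real.cos w = 2 * ρ * Real.cos (t - θ) := by linarith
    exact mul_left_cancel₀ (by linarith) this
  obtain ⟨k, hk | hk⟩ := Real.cos_eq_cos_iff.1 h2
  · right; rw [Circle.exp_eq_exp]; exact ⟨k, by linarith⟩
  · left; rw [Circle.exp_eq_exp]; exact ⟨k, by linarith⟩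

end Polar

/-- The boundary circle of the disk crosses the unit circle at two points. -/
def Proper (p : ℂ × ℝ) : Prop := |1 - ‖p.1‖| < p.2 ∧ p.2 < 1 + ‖p.1‖

/-- The discontinuities of a signal on the circle. -/
def ends (p : ℂ × ℝ) : Set Circle := {x | ¬ ContinuousAt (circleSignal p) x}

lemma circleSignal_eq_one {p : ℂ × ℝ} (h : 1 + ‖p.1‖ ≤ p.2) : circleSignal p = 1 := by
  funext x
  rw [circleSignal, signal, if_pos]
  · rfl
  · calc ‖(x : ℂ) - p.1‖ ≤ ‖(x : ℂ)‖ + ‖p.1‖ := norm_sub_le _ _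
      _ ≤ p.2 := by rwa [Circle.norm_coe]

lemma circleSignal_eq_zero {p : ℂ × ℝ} (h : p.2 < |1 - ‖p.1‖|) : circleSignal p = 0 := by
  funext x
  rw [circleSignal, signal, if_neg]
  · rfl
  · have := abs_norm_sub_norm_le (x : ℂ) p.1
    rw [Circle.norm_coe] at this
    linarith

/-- Half of the angle that the arc of a proper signal spans. -/
noncomputable def halfWidth (p : ℂ × ℝ) : ℝ :=
  Real.arccos ((1 + ‖p.1‖ ^ 2 - p.2 ^ 2) / (2 * ‖p.1‖))

namespace Proper

variable {p : ℂ × ℝ}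

lemma norm_pos (h : Proper p) : 0 < ‖p.1‖ := by
  rcases (norm_nonneg p.1).eq_or_lt with h0 | h0
  · have := h.1.trans h.2; rw [← h0] at this; norm_num at this
  · exact h0

lemma radius_pos (h : Proper p) : 0 < p.2 := (abs_nonneg _).trans_lt h.1

lemma halfWidth_spec (h : Proper p) : 0 < halfWidth p ∧ halfWidth p < Real.pi ∧
    1 + ‖p.1‖ ^ 2 - p.2 ^ 2 = 2 * ‖p.1‖ * Real.cos (halfWidth p) := by
  have h0 := h.norm_pos
  have h1 := h.radius_pos
  have h2 : (1 - ‖p.1‖) ^ 2 < p.2 ^ 2 := by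
    rw [← sq_abs]; exact pow_lt_pow_left₀ h.1 (abs_nonneg _) two_ne_zero
  have h3 : p.2 ^ 2 < (1 + ‖p.1‖) ^ 2 := pow_lt_pow_left₀ h.2 h1.le two_ne_zero
  have h4 : (1 + ‖p.1‖ ^ 2 - p.2 ^ 2) / (2 * ‖p.1‖) < 1 := by
    rw [div_lt_one (by linarith)]; nlinarith
  have h5 : -1 < (1 + ‖p.1‖ ^ 2 - p.2 ^ 2) / (2 * ‖p.1‖) := by
    rw [lt_div_iff₀ (by linarith)]; nlinarith
  refine ⟨Real.arccos_pos.2 h4, ?_, ?_⟩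
  · rw [← Real.arccos_neg_one]
    exact Real.strictAntiOn_arccos ⟨le_rfl, by norm_num⟩ ⟨h5.le, h4.le⟩ h5
  · rw [halfWidth, Real.cos_arccos h5.le h4.le]; field_simp

variable {θ : ℝ}

lemma circleSignal_eq (h : Proper p) (hθ : p.1 = ‖p.1‖ * (Circle.exp θ : Circle)) :
    circleSignal p = arc (Circle.exp (θ - halfWidth p)) (Circle.exp (θ + halfWidth p)) := by
  obtain ⟨h0, h1, h2⟩ := h.halfWidth_spec
  rw [← circleSignal_polar h.norm_pos h.radius_pos.le h0 h1 h2, ← hθ]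

lemma ends_eq (h : Proper p) (hθ : p.1 = ‖p.1‖ * (Circle.exp θ : Circle)) :
    ends p = {Circle.exp (θ - halfWidth p), Circle.exp (θ + halfWidth p)} := by
  ext x
  rw [ends, h.circleSignal_eq hθ]
  exact not_continuousAt_arc_iff (exp_sub_ne_exp_add θ h.halfWidth_spec.1 h.halfWidth_spec.2.1)

lemma center_eq (p : ℂ × ℝ) : p.1 = ‖p.1‖ * (Circle.exp p.1.arg : Circle) := by
  rw [Circle.coe_exp, Complex.norm_mul_exp_arg_mul_I]

lemma exists_arc (h : Proper p) : ∃ a b, a ≠ b ∧ circleSignal p = arc a b ∧ ends p = {a, b} :=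
  ⟨_, _, exp_sub_ne_exp_add _ h.halfWidth_spec.1 h.halfWidth_spec.2.1,
    h.circleSignal_eq (center_eq p), h.ends_eq (center_eq p)⟩

lemma mem_ends_of_norm_eq (h : Proper p) {x : Circle} (hx : ‖(x : ℂ) - p.1‖ = p.2) :
    x ∈ ends p := by
  rw [h.ends_eq (center_eq p)]
  rw [center_eq p] at hx
  exact eq_of_norm_sub_eq h.norm_pos h.halfWidth_spec.2.2 hx

end Proper

/-- Put the centre on the unit circle at the midpoint of the arc; the radius is then the chord
subtending half of the arc. -/
lemma exists_proper_of_ne {a b : Circle} (hab : a ≠ b) : ∃ p, Proper p ∧ circleSignal p = arc a b := by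
  set w := Circle.angleDiff a b / 2 with hw
  have hw0 : 0 < w := by have := Circle.angleDiff_pos hab; linarith
  have hw1 : w < Real.pi := by have := Circle.angleDiff_lt_two_pi a b; linarith
  obtain ⟨t, rfl⟩ := Circle.exp_surjective a
  have hs : 0 < Real.sin (w / 2) := Real.sin_pos_of_pos_of_lt_pi (by linarith) (by linarith)
  have hs1 : Real.sin (w / 2) < 1 := by
    rw [← Real.sin_pi_div_two]
    exact Real.strictMonoOn_sin ⟨by linarith, by linarith⟩ ⟨by linarith, le_rfl⟩ (by linarith)
  refine ⟨((1 : ℝ) * (Circle.exp (t + w) : Circle), 2 * Real.sin (w / 2)), ⟨?_, ?_⟩, ?_⟩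
  · simpa using hs
  · simp; linarith
  · rw [circleSignal_polar one_pos (by positivity) hw0 hw1]
    · rw [add_sub_cancel_right, add_assoc, ← two_mul, Circle.exp_add, hw,
        mul_div_cancel₀ _ two_ne_zero, mul_exp_angleDiff]
    · have := Real.cos_sq_add_sin_sq (w / 2)
      have h2 := Real.cos_two_mul (w / 2)
      rw [mul_div_cancel₀ _ two_ne_zero] at h2
      rw [h2]; nlinarith

/-! ### Discontinuities of sums of signals -/

lemma eventually_circleSignal_eq {p : ℂ × ℝ} {x : Circle} (h : ‖(x : ℂ) - p.1‖ ≠ p.2) :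
    ∀ᶠ q in 𝓝 (p, x), circleSignal q.1 q.2 = circleSignal p x := by
  have hc1 : Continuous fun q : (ℂ × ℝ) × Circle => ‖(q.2 : ℂ) - q.1.1‖ := by fun_prop
  have hc2 : Continuous fun q : (ℂ × ℝ) × Circle => q.1.2 := by fun_prop
  rcases h.lt_or_gt with h | h
  · filter_upwards [(hc1.tendsto (p, x)).eventually_lt (hc2.tendsto (p, x)) h] with q hq
    rw [circleSignal, circleSignal, signal, signal, if_pos hq.le, if_pos h.le]
  · filter_upwards [(hc2.tendsto (p, x)).eventually_lt (hc1.tendsto (p, x)) h] with q hq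
    rw [circleSignal, circleSignal, signal, signal, if_neg hq.not_ge, if_neg h.not_ge]

lemma norm_eq_of_mem_ends {p : ℂ × ℝ} {x : Circle} (h : x ∈ ends p) : ‖(x : ℂ) - p.1‖ = p.2 := by
  by_contra hne
  refine h (continuousAt_iff_eventually.2 ?_)
  exact (Continuous.prodMk_right p).continuousAt.eventually (eventually_circleSignal_eq hne)

lemma circleSignal_le_one (p : ℂ × ℝ) (x : Circle) : circleSignal p x ≤ 1 := by
  unfold circleSignal signal; split_ifs <;> simp

lemma eventually_circleSignal_le (p : ℂ × ℝ) (x : Circle) :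
    ∀ᶠ y in 𝓝 x, circleSignal p y ≤ circleSignal p x := by
  by_cases h : ‖(x : ℂ) - p.1‖ ≤ p.2
  · have : circleSignal p x = 1 := by rw [circleSignal, signal, if_pos h]
    exact Eventually.of_forall fun y => this ▸ circleSignal_le_one p y
  · have hx : ContinuousAt (circleSignal p) x :=
      not_not.1 fun hx => h (norm_eq_of_mem_ends hx).le
    exact (continuousAt_iff_eventually.1 hx).mono fun y hy => hy.le

/-- Discontinuities cannot cancel: near `x` each summand is at most its value at `x`, so a locally
constant sum forces every summand to be locally constant. -/
lemma not_continuousAt_totalSignal {n : ℕ} (v : Fin n → ℂ × ℝ) (x : Circle) :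
    ¬ ContinuousAt (totalSignal v) x ↔ ∃ i, x ∈ ends (v i) := by
  rw [← not_iff_not, not_not, not_exists]
  simp only [ends, Set.mem_ofPred_eq, not_not, continuousAt_iff_eventually]
  constructor
  · intro h i
    filter_upwards [h, eventually_all.2 fun j => eventually_circleSignal_le (v j) x] with y hy hle
    exact (Finset.sum_eq_sum_iff_of_le fun j _ => hle j).1 hy i (Finset.mem_univ i)
  · intro h
    filter_upwards [eventually_all.2 h] with y hy
    exact Finset.sum_congr rfl fun j _ => hy j

lemma subsingleton_ends {p : ℂ × ℝ} (h : p.2 = |1 - ‖p.1‖|) (h' : p.2 < 1 + ‖p.1‖) :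
    (ends p).Subsingleton := by
  have hρ : 0 < ‖p.1‖ := by
    rcases (norm_nonneg p.1).eq_or_lt with h0 | h0
    · rw [h, ← h0] at h'; norm_num at h'
    · exact h0
  have key : ∀ x ∈ ends p, x = Circle.exp p.1.arg := by
    intro x hx
    have := norm_eq_of_mem_ends hx
    rw [Proper.center_eq p] at this
    have := eq_of_norm_sub_eq (w := 0) hρ (by rw [h, sq_abs]; simp; ring) this
    simpa using this
  intro x hx y hy
  rw [key x hx, key y hy]

lemma ends_eq_empty {p : ℂ × ℝ} (h : 1 + ‖p.1‖ ≤ p.2 ∨ p.2 < |1 - ‖p.1‖|) : ends p = ∅ := by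
  rw [ends, Set.eq_empty_iff_forall_notMem]
  intro x hx
  apply hx
  rcases h with h | h
  · rw [circleSignal_eq_one h]; exact continuousAt_const
  · rw [circleSignal_eq_zero h]; exact continuousAt_const

lemma finite_ends (p : ℂ × ℝ) : (ends p).Finite := by
  rcases le_or_gt (1 + ‖p.1‖) p.2 with h | h
  · simp [ends_eq_empty (Or.inl h)]
  · rcases lt_trichotomy p.2 |1 - ‖p.1‖| with h' | h' | h'
    · simp [ends_eq_empty (Or.inr h')]
    · exact (subsingleton_ends h' h).finite
    · obtain ⟨a, b, -, -, hE⟩ := Proper.exists_arc ⟨h', h⟩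
      rw [hE]; simp

lemma setOf_not_continuousAt_totalSignal {n : ℕ} (v : Fin n → ℂ × ℝ) :
    {x | ¬ ContinuousAt (totalSignal v) x} = ⋃ i, ends (v i) := by
  ext x; rw [Set.mem_ofPred_eq, not_continuousAt_totalSignal, Set.mem_iUnion]

lemma piecewiseConst_totalSignal {n : ℕ} (v : Fin n → ℂ × ℝ) : PiecewiseConst (totalSignal v) := by
  rw [PiecewiseConst, setOf_not_continuousAt_totalSignal]
  exact Set.finite_iUnion fun i => finite_ends _

/-! ### What robustness forces -/

/-- In a robust decomposition the endpoints of every arc are not shared with other signals. -/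
lemma Robust.one_lt_ncard_ends {n : ℕ} {v : Fin n → ℂ × ℝ} (hv : Robust v) (i : Fin n)
    (h1 : |1 - ‖(v i).1‖| ≤ (v i).2) (h2 : (v i).2 < 1 + ‖(v i).1‖) :
    1 < (ends (v i) \ ⋃ j ∈ {j | j ≠ i}, ends (v j)).ncard := by
  obtain ⟨δ, hδ, H⟩ := hv
  set S : Set Circle := ⋃ j ∈ {j | j ≠ i}, ends (v j) with hS
  have hSfin : S.Finite := Set.Finite.biUnion (Set.toFinite _) fun j _ => finite_ends _
  -- A slightly larger radius, avoiding the finitely many values for which the boundary meets an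
  -- endpoint of another signal.
  obtain ⟨r, ⟨hr1, hr2⟩, hr3⟩ : ∃ r ∈ Set.Ioo (v i).2 (min ((v i).2 + δ) (1 + ‖(v i).1‖)),
      r ∉ (fun x : Circle => ‖(x : ℂ) - (v i).1‖) '' S :=
    (Set.Ioo_infinite (lt_min (by linarith) h2)).exists_notMem_finite (hSfin.image _)
  rw [lt_min_iff] at hr2
  set ε := r - (v i).2 with hε
  set u : Fin n → ℂ × ℝ := Pi.single i (0, 1) with hu
  have hseq := H ε ⟨by linarith, by linarith [hr2.1]⟩ u (by
    rw [Finset.sum_eq_single i]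
    · simp [hu]
    · intro j _ hj; simp [hu, hj]
    · simp)
  set v' := v + ε • u with hv'
  have hvi : v' i = ((v i).1, r) := by
    ext <;> simp [hv', hu, hε]
  have hvj : ∀ j, j ≠ i → v' j = v j := by
    intro j hj
    ext <;> simp [hv', hu, hj]
  have hp : Proper (v' i) := by
    rw [hvi]; exact ⟨h1.trans_lt hr1, hr2.2⟩
  obtain ⟨a, b, hab, -, hE⟩ := hp.exists_arc
  have hlen := congrArg Cycle.length hseq
  rw [length_seqRep (piecewiseConst_totalSignal _), length_seqRep (piecewiseConst_totalSignal _),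
    setOf_not_continuousAt_totalSignal, setOf_not_continuousAt_totalSignal] at hlen
  have hU : ⋃ j, ends (v j) = (ends (v i) \ S) ∪ S := by
    rw [Set.sdiff_union_self, hS]
    ext x
    simp only [Set.mem_iUnion, Set.mem_union, Set.mem_ofPred_eq, exists_prop]
    constructor
    · rintro ⟨j, hj⟩
      by_cases hji : j = i
      · exact Or.inl (hji ▸ hj)
      · exact Or.inr ⟨j, hji, hj⟩
    · rintro (h | ⟨j, -, hj⟩)
      exacts [⟨i, h⟩, ⟨j, hj⟩]
  have hU' : ⋃ j, ends (v' j) = {a, b} ∪ S := by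
    rw [← hE, hS]
    ext x
    simp only [Set.mem_iUnion, Set.mem_union, Set.mem_ofPred_eq, exists_prop]
    constructor
    · rintro ⟨j, hj⟩
      by_cases hji : j = i
      · exact Or.inl (hji ▸ hj)
      · exact Or.inr ⟨j, hji, hvj j hji ▸ hj⟩
    · rintro (h | ⟨j, hji, hj⟩)
      exacts [⟨i, h⟩, ⟨j, (hvj j hji).symm ▸ hj⟩]
  have hdisj : Disjoint ({a, b} : Set Circle) S := by
    rw [← hE, Set.disjoint_left]
    intro x hx hxS
    have := norm_eq_of_mem_ends hx
    rw [hvi] at this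
    exact hr3 ⟨x, hxS, this⟩
  have hc' : ({a, b} ∪ S).ncard = 2 + S.ncard := by
    rw [Set.ncard_union_eq hdisj (Set.toFinite _) hSfin, Set.ncard_pair hab]
  -- After the perturbation there are `2 + S.ncard` discontinuities, so the `max 1` in the lengths
  -- cannot hide a loss.
  have hc : ((ends (v i) \ S) ∪ S).ncard ≤ (ends (v i) \ S).ncard + S.ncard := Set.ncard_union_le _ _
  rw [hU, hU', hc'] at hlen
  omega

/-- In the remaining case, tangency, there is at most one endpoint, while `Robust.one_lt_ncard_ends`
asks for two. -/
lemma Robust.proper {n : ℕ} {v : Fin n → ℂ × ℝ} (hv : Robust v) (i : Fin n)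
    (h1 : |1 - ‖(v i).1‖| ≤ (v i).2) (h2 : (v i).2 < 1 + ‖(v i).1‖) : Proper (v i) := by
  refine ⟨lt_of_le_of_ne h1 fun h => ?_, h2⟩
  have := hv.one_lt_ncard_ends i h1 h2
  have hs := (subsingleton_ends h.symm h2).anti (Set.sdiff_subset (t := ⋃ j ∈ {j | j ≠ i}, ends (v j)))
  have := (Set.ncard_le_one (hs.finite)).2 fun a ha b hb => hs ha hb
  omega

/-- An arc has only two endpoints and both are needed as unshared ones. -/
lemma Robust.disjoint_ends {n : ℕ} {v : Fin n → ℂ × ℝ} (hv : Robust v) {i j : Fin n}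
    (hij : j ≠ i) : Disjoint (ends (v i)) (ends (v j)) := by
  rcases le_or_gt (1 + ‖(v i).1‖) (v i).2 with h2 | h2
  · simp [ends_eq_empty (Or.inl h2)]
  rcases lt_or_ge (v i).2 |1 - ‖(v i).1‖| with h1 | h1
  · simp [ends_eq_empty (Or.inr h1)]
  obtain ⟨a, b, -, -, hE⟩ := (hv.proper i h1 h2).exists_arc
  have h3 := hv.one_lt_ncard_ends i h1 h2
  rw [Set.disjoint_left]
  intro x hx hxj
  have hxS : x ∈ ⋃ j ∈ {j | j ≠ i}, ends (v j) := Set.mem_biUnion (x := j) hij hxj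
  have : (ends (v i) \ ⋃ j ∈ {j | j ≠ i}, ends (v j)) ⊆ ends (v i) \ {x} :=
    Set.sdiff_subset_sdiff_right (by simpa using hxS)
  have h4 := Set.ncard_le_ncard this ((finite_ends _).sdiff)
  rw [Set.ncard_sdiff_singleton_of_mem hx] at h4
  have := Set.ncard_insert_le a {b}
  rw [Set.ncard_singleton, ← hE] at this
  omega

/-! ### Stable signals with disjoint endpoints are robust -/

/-- The two circles cross at two points, or the disk contains the unit circle in its interior. -/
def Stable (p : ℂ × ℝ) : Prop := Proper p ∨ 1 + ‖p.1‖ < p.2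

lemma Stable.norm_ne {p : ℂ × ℝ} (h : Stable p) {x : Circle} (hx : x ∉ ends p) :
    ‖(x : ℂ) - p.1‖ ≠ p.2 := by
  intro he
  rcases h with h | h
  · exact hx (h.mem_ends_of_norm_eq he)
  · have := norm_sub_le (x : ℂ) p.1
    rw [Circle.norm_coe] at this
    linarith

lemma eventually_proper {p : ℂ × ℝ} (h : Proper p) : ∀ᶠ q in 𝓝 p, Proper q := by
  have h1 : Continuous fun q : ℂ × ℝ => |1 - ‖q.1‖| := by fun_prop
  have h2 : Continuous fun q : ℂ × ℝ => q.2 := by fun_prop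
  have h3 : Continuous fun q : ℂ × ℝ => 1 + ‖q.1‖ := by fun_prop
  exact ((h1.tendsto p).eventually_lt (h2.tendsto p) h.1).and
    ((h2.tendsto p).eventually_lt (h3.tendsto p) h.2)

lemma continuousAt_halfWidth {p : ℂ × ℝ} (h : Proper p) : ContinuousAt halfWidth p := by
  have h0 : 2 * ‖p.1‖ ≠ 0 := by have := h.norm_pos; positivity
  refine Real.continuous_arccos.continuousAt.comp ?_
  exact ContinuousAt.div (by fun_prop) (by fun_prop) h0

/-- The endpoints of a stable signal depend continuously on the data. -/
lemma Stable.exists_lifts {p₀ : ℂ × ℝ} (h : Stable p₀) : ∃ A : Circle → ℂ × ℝ → ℝ,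
    (∀ x ∈ ends p₀, ContinuousAt (A x) p₀ ∧ A x p₀ = Circle.angleDiff 1 x) ∧
    ∀ᶠ p in 𝓝 p₀, ends p = (fun x => Circle.exp (A x p)) '' ends p₀ := by
  classical
  rcases h with h | h
  · set θ₀ := p₀.1.arg with hθ₀
    have hm₀ : p₀.1 ≠ 0 := norm_pos_iff.1 h.norm_pos
    -- A branch of the argument of the centre that is continuous at `p₀`: the quotient is near `1`,
    -- away from the cut of `arg`.
    set θ : ℂ × ℝ → ℝ := fun p => θ₀ + (p.1 / p₀.1).arg with hθ
    have hθ0 : θ p₀ = θ₀ := by simp [hθ, hm₀]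
    have hcθ : ContinuousAt θ p₀ := by
      refine continuousAt_const.add ?_
      have : ContinuousAt Complex.arg (p₀.1 / p₀.1) :=
        Complex.continuousAt_arg (by simp [hm₀])
      exact ContinuousAt.comp (f := fun p : ℂ × ℝ => p.1 / p₀.1) this (by fun_prop)
    have hcenter : ∀ p : ℂ × ℝ, p.1 = ‖p.1‖ * (Circle.exp (θ p) : Circle) := by
      intro p
      have h1 := Proper.center_eq p₀
      have h2 := Complex.norm_mul_exp_arg_mul_I (p.1 / p₀.1)
      rw [norm_div, Complex.ofReal_div] at h2
      have h3 : (‖p₀.1‖ : ℂ) ≠ 0 := by exact_mod_cast h.norm_pos.ne'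
      have h4 : p.1 = ‖p₀.1‖ * Complex.exp (θ₀ * Complex.I) *
          (‖p.1‖ / ‖p₀.1‖ * Complex.exp ((p.1 / p₀.1).arg * Complex.I)) := by
        rw [h2, ← Circle.coe_exp, ← h1]; field_simp
      conv_lhs => rw [h4]
      rw [Circle.coe_exp, hθ]
      push_cast
      rw [add_mul, Complex.exp_add]
      field_simp
    set a := Circle.exp (θ₀ - halfWidth p₀) with ha
    set b := Circle.exp (θ₀ + halfWidth p₀) with hb
    have hab : a ≠ b := exp_sub_ne_exp_add _ h.halfWidth_spec.1 h.halfWidth_spec.2.1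
    have hw := continuousAt_halfWidth h
    have hcancel : ∀ s t : ℝ, Circle.exp (Circle.angleDiff 1 (Circle.exp s) + (t - s)) =
        Circle.exp t := fun s t => by
      have := mul_exp_angleDiff 1 (Circle.exp s)
      rw [one_mul] at this
      rw [Circle.exp_add, this, ← Circle.exp_add, add_sub_cancel]
    have hE : ends p₀ = {a, b} := by rw [h.ends_eq (hcenter p₀), hθ0]
    -- The displacement of the endpoint is added to its angle in `[0, 2π)`, so that the lift starts
    -- at the angle listed in `discAngles`.
    refine ⟨fun x p => Circle.angleDiff 1 x + if x = a
      then (θ p - halfWidth p) - (θ₀ - halfWidth p₀)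
      else (θ p + halfWidth p) - (θ₀ + halfWidth p₀), fun x hx => ⟨?_, ?_⟩, ?_⟩
    · by_cases hxa : x = a
      · simp only [hxa, if_true]
        exact continuousAt_const.add ((hcθ.sub hw).sub continuousAt_const)
      · simp only [hxa, if_false]
        exact continuousAt_const.add ((hcθ.add hw).sub continuousAt_const)
    · simp [hθ0]
    · filter_upwards [eventually_proper h] with p hp
      rw [hE, hp.ends_eq (hcenter p), Set.image_pair, if_pos rfl, if_neg hab.symm, ha, hb, hcancel,
        hcancel]
  · refine ⟨fun _ _ => 0, fun x hx => ?_, ?_⟩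
    · rw [ends_eq_empty (Or.inl h.le)] at hx
      exact absurd hx (Set.notMem_empty x)
    · have h2 : Continuous fun q : ℂ × ℝ => q.2 := by fun_prop
      have h3 : Continuous fun q : ℂ × ℝ => 1 + ‖q.1‖ := by fun_prop
      filter_upwards [(h3.tendsto p₀).eventually_lt (h2.tendsto p₀) h] with p hp
      rw [ends_eq_empty (Or.inl h.le), ends_eq_empty (Or.inl hp.le), Set.image_empty]

section

variable {n : ℕ} {v : Fin n → ℂ × ℝ}

lemma eventually_totalSignal_eq (hst : ∀ i, Stable (v i)) {x : Circle}
    (hx : ContinuousAt (totalSignal v) x) :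
    ∀ᶠ q in 𝓝 (v, x), totalSignal q.1 q.2 = totalSignal v x := by
  have h1 : ∀ i, x ∉ ends (v i) := fun i hi =>
    (not_continuousAt_totalSignal v x).2 ⟨i, hi⟩ hx
  have h2 : ∀ i, ∀ᶠ q in 𝓝 (v, x), circleSignal (q.1 i) q.2 = circleSignal (v i) x := by
    intro i
    have hc : Continuous fun q : (Fin n → ℂ × ℝ) × Circle => (q.1 i, q.2) := by fun_prop
    exact (hc.tendsto (v, x)).eventually (eventually_circleSignal_eq ((hst i).norm_ne (h1 i)))
  filter_upwards [eventually_all.2 h2] with q hq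
  exact Finset.sum_congr rfl fun i _ => hq i

/-- Under small perturbations the lifted endpoints keep their order and span less than a full turn,
and each midpoint keeps its value. A lift near `0` may become negative, which is why
`seqRep_eq_of_lifts` is needed. -/
lemma eventually_seqRep_eq (hst : ∀ i, Stable (v i))
    (hdisj : ∀ i j, j ≠ i → Disjoint (ends (v i)) (ends (v j))) :
    ∀ᶠ v' in 𝓝 v, seqRep (totalSignal v') = seqRep (totalSignal v) := by
  classical
  have hpi := Real.two_pi_pos
  choose A hA hAends using fun i => (hst i).exists_lifts
  have hfin := finite_discAngles (piecewiseConst_totalSignal v)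
  set l := hfin.toFinset.sort (· ≤ ·) with hl
  have hmem : ∀ {t}, t ∈ l ↔ (0 ≤ t ∧ t < 2 * Real.pi) ∧ ∃ i, Circle.exp t ∈ ends (v i) := by
    intro t
    rw [hl, Finset.mem_sort, Set.Finite.mem_toFinset, discAngles, Set.mem_ofPred_eq,
      not_continuousAt_totalSignal, Set.mem_Ico]
  have hsort : l.Pairwise (· < ·) := Finset.sortedLT_sort _ |>.pairwise
  have hang : ∀ t ∈ l, Circle.angleDiff 1 (Circle.exp t) = t := by
    intro t ht
    simpa using angleDiff_mul_exp 1 (hmem.1 ht).1.1 (hmem.1 ht).1.2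
  -- The perturbed position of the endpoint at angle `t`. Disjointness makes the signal owning it
  -- unique; the value `0` is never used for `t ∈ l`.
  set B : ℝ → (Fin n → ℂ × ℝ) → ℝ := fun t v' =>
    if h : ∃ i, Circle.exp t ∈ ends (v i) then A h.choose (Circle.exp t) (v' h.choose) else 0
    with hB
  have hBeq : ∀ t i, Circle.exp t ∈ ends (v i) → ∀ v', B t v' = A i (Circle.exp t) (v' i) := by
    intro t i hi v'
    have h : ∃ i, Circle.exp t ∈ ends (v i) := ⟨i, hi⟩
    have : h.choose = i := by
      by_contra hne
      exact Set.disjoint_left.1 (hdisj i h.choose hne) hi h.choose_spec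
    simp only [hB]
    rw [dif_pos h, this]
  have hBc : ∀ t ∈ l, ContinuousAt (B t) v ∧ B t v = t := by
    intro t ht
    obtain ⟨-, i, hi⟩ := hmem.1 ht
    rw [show B t = fun v' => A i (Circle.exp t) (v' i) from funext (hBeq t i hi)]
    refine ⟨ContinuousAt.comp (f := fun v' : Fin n → ℂ × ℝ => v' i) (hA i _ hi).1
      (continuous_apply i).continuousAt, ?_⟩
    change A i (Circle.exp t) (v i) = t
    rw [(hA i _ hi).2, hang t ht]
  have hall : ∀ {P : ℝ → (Fin n → ℂ × ℝ) → Prop}, (∀ t ∈ l, ∀ᶠ v' in 𝓝 v, P t v') →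
      ∀ᶠ v' in 𝓝 v, ∀ t ∈ l, P t v' := by
    intro P h
    have := (Finset.eventually_all l.toFinset (l := 𝓝 v) (p := P)).2 (by simpa using h)
    simpa using this
  have hlt : ∀ t ∈ l, ∀ᶠ v' in 𝓝 v, ∀ s ∈ l, t < s → B t v' < B s v' := by
    refine fun t ht => hall fun s hs => ?_
    by_cases hts : t < s
    · have := (hBc t ht).1.eventually_lt (hBc s hs).1 (by rwa [(hBc t ht).2, (hBc s hs).2])
      exact this.mono fun _ h _ => h
    · exact Eventually.of_forall fun _ h => absurd h hts
  have hwrap : ∀ s ∈ l, ∀ᶠ v' in 𝓝 v, ∀ t ∈ l, B t v' < B s v' + 2 * Real.pi := by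
    refine fun s hs => hall fun t ht => ?_
    refine (hBc t ht).1.eventually_lt ((hBc s hs).1.add continuousAt_const) ?_
    rw [(hBc t ht).2, (hBc s hs).2]
    linarith [(hmem.1 ht).1.2, (hmem.1 hs).1.1]
  have hrange : ∀ t ∈ l, ∀ᶠ v' in 𝓝 v, -(2 * Real.pi) ≤ B t v' ∧ B t v' < 2 * Real.pi := by
    intro t ht
    have h1 := (hBc t ht).1.eventually_const_lt (u := -(2 * Real.pi))
      (by rw [(hBc t ht).2]; linarith [(hmem.1 ht).1.1])
    have h2 := (hBc t ht).1.eventually_lt_const (u := 2 * Real.pi)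
      (by rw [(hBc t ht).2]; exact (hmem.1 ht).1.2)
    filter_upwards [h1, h2] with v' h1 h2 using ⟨h1.le, h2⟩
  have hval : ∀ c : ℝ, ∀ s ∈ l, ∀ᶠ v' in 𝓝 v, ∀ t ∈ l,
      ContinuousAt (totalSignal v) (Circle.exp ((s + (t + c)) / 2)) →
      totalSignal v' (Circle.exp ((B s v' + (B t v' + c)) / 2)) =
        totalSignal v (Circle.exp ((s + (t + c)) / 2)) := by
    refine fun c s hs => hall fun t ht => ?_
    by_cases hc : ContinuousAt (totalSignal v) (Circle.exp ((s + (t + c)) / 2))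
    · have hcont : ContinuousAt
          (fun v' => (v', Circle.exp ((B s v' + (B t v' + c)) / 2))) v := by
        refine continuousAt_id.prodMk (Circle.exp.continuous.continuousAt.comp ?_)
        exact ((hBc s hs).1.add ((hBc t ht).1.add continuousAt_const)).div_const 2
      have hx := eventually_totalSignal_eq hst hc
      rw [ContinuousAt, (hBc t ht).2, (hBc s hs).2] at hcont
      exact (hcont.eventually hx).mono fun _ h _ => h
    · exact Eventually.of_forall fun _ h => absurd h hc
  have hnil : ∀ᶠ v' in 𝓝 v, l = [] → totalSignal v' 1 = totalSignal v 1 := by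
    by_cases hl0 : l = []
    · have hc : ContinuousAt (totalSignal v) 1 := by
        by_contra hc
        rw [not_continuousAt_totalSignal] at hc
        have : (0 : ℝ) ∈ l := hmem.2 ⟨⟨le_rfl, hpi⟩, by simpa using hc⟩
        simp [hl0] at this
      have h := (Continuous.prodMk_left (1 : Circle)).continuousAt.eventually
        (eventually_totalSignal_eq hst hc)
      exact h.mono fun _ h _ => h
    · exact Eventually.of_forall fun _ h => absurd h hl0
  have hdv : ∀ x, ¬ ContinuousAt (totalSignal v) x ↔ ∃ t ∈ l, Circle.exp t = x := by
    intro x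
    rw [not_continuousAt_totalSignal]
    constructor
    · intro h
      have hx : Circle.exp (Circle.angleDiff 1 x) = x := by simpa using mul_exp_angleDiff 1 x
      exact ⟨Circle.angleDiff 1 x, hmem.2 ⟨⟨Circle.angleDiff_nonneg 1 x,
        Circle.angleDiff_lt_two_pi 1 x⟩, by rwa [hx]⟩, hx⟩
    · rintro ⟨t, ht, rfl⟩; exact (hmem.1 ht).2
  have hends : ∀ᶠ v' in 𝓝 v, ∀ i, ends (v' i) = (fun x => Circle.exp (A i x (v' i))) '' ends (v i) :=
    eventually_all.2 fun i => (continuous_apply i).continuousAt.eventually (hAends i)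
  filter_upwards [hall hlt, hall hwrap, hall hrange, hall (hval 0), hall (hval (2 * Real.pi)),
    hnil, hends] with v' h1 h2 h3 h4 h5 h6 h7
  rw [seqRep_eq_arcValues hsort (fun t ht => (hmem.1 ht).1) hdv,
    ← arcValues_map (F' := totalSignal v') (fun t => B t v') hsort (fun t ht => (hmem.1 ht).1) hdv h6
      (by simpa using h4) h5]
  apply seqRep_eq_of_lifts
  · rw [List.pairwise_map]
    exact hsort.imp_of_mem fun hs ht hst => h1 _ hs _ ht hst
  · simpa using h3
  · simpa using h2
  · intro x
    rw [not_continuousAt_totalSignal]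
    constructor
    · rintro ⟨i, hi⟩
      rw [h7 i] at hi
      obtain ⟨y, hy, rfl⟩ := hi
      obtain ⟨t, ht, rfl⟩ := (hdv y).1 ((not_continuousAt_totalSignal v y).2 ⟨i, hy⟩)
      exact ⟨B t v', List.mem_map_of_mem ht, by rw [hBeq t i hy]⟩
    · rintro ⟨s, hs, rfl⟩
      obtain ⟨t, ht, rfl⟩ := List.mem_map.1 hs
      obtain ⟨-, i, hi⟩ := hmem.1 ht
      refine ⟨i, ?_⟩
      rw [h7 i, hBeq t i hi]
      exact ⟨_, hi, rfl⟩

theorem robust_of_stable (hst : ∀ i, Stable (v i))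
    (hdisj : ∀ i j, j ≠ i → Disjoint (ends (v i)) (ends (v j))) : Robust v := by
  obtain ⟨δ, hδ, H⟩ := Metric.eventually_nhds_iff.1 (eventually_seqRep_eq hst hdisj)
  refine ⟨δ, hδ, fun ε hε u hu => H ?_⟩
  -- The topology on the data comes from the sup norm, which is bounded by the Euclidean one.
  rw [Real.sqrt_eq_one] at hu
  have hterm : ∀ i, ‖(u i).1‖ ^ 2 + (u i).2 ^ 2 ≤ 1 := by
    intro i
    rw [← hu]
    exact Finset.single_le_sum (f := fun i => ‖(u i).1‖ ^ 2 + (u i).2 ^ 2)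
      (fun j _ => by positivity) (Finset.mem_univ i)
  have hnorm : ‖u‖ ≤ 1 := by
    refine (pi_norm_le_iff_of_nonneg zero_le_one).2 fun i => ?_
    rw [Prod.norm_def, max_le_iff]
    have h1 := hterm i
    have h2 : (u i).2 ^ 2 = ‖(u i).2‖ ^ 2 := by rw [Real.norm_eq_abs, sq_abs]
    constructor
    · nlinarith [norm_nonneg (u i).1, sq_nonneg (u i).2]
    · nlinarith [norm_nonneg (u i).2, sq_nonneg ‖(u i).1‖]
  rw [dist_eq_norm, add_sub_cancel_left, norm_smul, Real.norm_eq_abs, abs_of_pos hε.1]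
  calc ε * ‖u‖ ≤ ε * 1 := by gcongr; exact hε.1.le
    _ < δ := by rw [mul_one]; exact hε.2

end

/-! ### Components of superlevel sets -/

lemma continuousAt_angleDiff {y x : Circle} (h : x ≠ y) :
    ContinuousAt (Circle.angleDiff y) x := by
  have h0 := Circle.angleDiff_pos h.symm
  have h1 := Circle.angleDiff_lt_two_pi y x
  rw [ContinuousAt, nhds_eq_map_exp x, tendsto_map'_iff]
  have h2 : Tendsto (fun t : ℝ => Circle.angleDiff y x + t) (𝓝 0) (𝓝 (Circle.angleDiff y x)) :=
    Continuous.tendsto' (by fun_prop) _ _ (add_zero _)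
  refine h2.congr' ?_
  filter_upwards [Ioo_mem_nhds (neg_lt_zero.2 h0) (sub_pos.2 h1)] with t ht
  have : x * Circle.exp t = y * Circle.exp (Circle.angleDiff y x + t) := by
    rw [Circle.exp_add, ← mul_assoc, mul_exp_angleDiff]
  rw [Function.comp_apply, this, angleDiff_mul_exp y (by linarith [ht.1]) (by linarith [ht.2])]

/-- A superlevel set has exactly one connected component for each point at which the function jumps up
across the level. -/
theorem nonempty_equiv_components_superlevel {g L R : Circle → ℕ} (hg : ∀ x, HasSides g x (L x) (R x))
    (hmax : ∀ x, g x = max (L x) (R x)) {k : ℕ} {y : Circle} (hy : g y < k) :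
    Nonempty ({a | L a < k ∧ k ≤ R a} ≃ ConnectedComponents {x : Circle // k ≤ g x}) := by
  have hpi := Real.two_pi_pos
  have hmem : ∀ a : {a | L a < k ∧ k ≤ R a}, k ≤ g a := fun a => by
    rw [hmax]; exact a.2.2.trans (le_max_right _ _)
  refine ⟨Equiv.ofBijective (fun a : {a | L a < k ∧ k ≤ R a} => (ConnectedComponents.mk ⟨a, hmem a⟩ :
      ConnectedComponents {x : Circle // k ≤ g x})) ⟨?_, ?_⟩⟩
  -- Measured from `y`, which lies outside the superlevel set, angles are continuous on it, so a
  -- component containing `a` and a later `b` contains the whole arc between them. But just before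
  -- `b` the function is below `k`.
  · have key : ∀ a b : {a | L a < k ∧ k ≤ R a},
        (ConnectedComponents.mk ⟨a, hmem a⟩ : ConnectedComponents {x : Circle // k ≤ g x}) =
          ConnectedComponents.mk ⟨b, hmem b⟩ →
        ¬ Circle.angleDiff y a < Circle.angleDiff y b := by
      intro a b hab hlt
      rw [ConnectedComponents.coe_eq_coe] at hab
      set C := connectedComponent (⟨a, hmem a⟩ : {x : Circle // k ≤ g x}) with hC
      have hne : ∀ x : {x : Circle // k ≤ g x}, (x : Circle) ≠ y := fun x hx => by
        have := x.2; rw [hx] at this; omega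
      have hconn : IsPreconnected
          ((fun x : {x : Circle // k ≤ g x} => Circle.angleDiff y x) '' C) :=
        isPreconnected_connectedComponent.image _ fun x _ =>
          (ContinuousAt.comp (f := Subtype.val) (continuousAt_angleDiff (hne x))
            continuous_subtype_val.continuousAt).continuousWithinAt
      obtain ⟨t, ht1, ht2⟩ := ((hg b).1.and (Ioo_mem_nhdsLT (sub_neg.2 hlt))).exists
      have hb := Circle.angleDiff_lt_two_pi y b
      have ha := Circle.angleDiff_nonneg y a
      have hz : Circle.angleDiff y (b * Circle.exp t) = Circle.angleDiff y b + t := by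
        have : (b : Circle) * Circle.exp t = y * Circle.exp (Circle.angleDiff y b + t) := by
          rw [Circle.exp_add, ← mul_assoc, mul_exp_angleDiff]
        rw [this, angleDiff_mul_exp y (by linarith [ht2.1]) (by linarith [ht2.2])]
      obtain ⟨c, -, hc⟩ := hconn.Icc_subset ⟨_, mem_connectedComponent, rfl⟩
        ⟨⟨b, hmem b⟩, hab ▸ mem_connectedComponent, rfl⟩
        (show Circle.angleDiff y (b * Circle.exp t) ∈
          Set.Icc (Circle.angleDiff y a) (Circle.angleDiff y b) by
            rw [hz]; constructor <;> linarith [ht2.1, ht2.2])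
      have hc' := c.2
      rw [angleDiff_inj.1 hc, ht1] at hc'
      exact b.2.1.not_ge hc'
    intro a b hab
    rcases lt_trichotomy (Circle.angleDiff y a) (Circle.angleDiff y b) with h | h | h
    · exact absurd h (key a b hab)
    · exact Subtype.ext (angleDiff_inj.1 h)
    · exact absurd h (key b a hab.symm)
  · intro c
    obtain ⟨⟨x, hx⟩, rfl⟩ := ConnectedComponents.surjective_coe c
    set m := Circle.angleDiff y x with hm
    have hm0 : 0 ≤ m := Circle.angleDiff_nonneg y x
    have hxm : y * Circle.exp m = x := mul_exp_angleDiff y x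
    -- Go back clockwise from `x` as long as the function is at least `k`. The infimum `p` still
    -- belongs to the set since `g` is the maximum of its one-sided values; a left value at least
    -- `k` there would allow going further, so the function jumps up at `p`.
    set S : Set ℝ := {s | (0 ≤ s ∧ s ≤ m) ∧ ∀ t, s ≤ t → t ≤ m → k ≤ g (y * Circle.exp t)} with hS
    have hmS : m ∈ S := by
      refine ⟨⟨hm0, le_rfl⟩, fun t h1 h2 => ?_⟩
      rw [le_antisymm h2 h1, hxm]; exact hx
    have hbdd : BddBelow S := ⟨0, fun s hs => hs.1.1⟩
    set p := sInf S with hp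
    have hp0 : 0 ≤ p := le_csInf ⟨m, hmS⟩ fun s hs => hs.1.1
    have hpm : p ≤ m := csInf_le hbdd hmS
    have hgood : ∀ t, p < t → t ≤ m → k ≤ g (y * Circle.exp t) := by
      intro t h1 h2
      obtain ⟨s, hs, hst⟩ := exists_lt_of_csInf_lt ⟨m, hmS⟩ h1
      exact hs.2 t hst.le h2
    have hexp : ∀ t, y * Circle.exp p * Circle.exp t = y * Circle.exp (p + t) := fun t => by
      rw [Circle.exp_add, mul_assoc]
    have hgp : k ≤ g (y * Circle.exp p) := by
      rcases hpm.eq_or_lt with h | h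
      · rw [h, hxm]; exact hx
      · obtain ⟨t, ht1, ht2⟩ :=
          ((hg (y * Circle.exp p)).2.and (Ioo_mem_nhdsGT (sub_pos.2 h))).exists
        rw [hexp] at ht1
        rw [hmax, ← ht1]
        exact (hgood _ (by linarith [ht2.1]) (by linarith [ht2.2])).trans (le_max_right _ _)
    have hpS : ∀ t, p ≤ t → t ≤ m → k ≤ g (y * Circle.exp t) := by
      intro t h1 h2
      rcases h1.eq_or_lt with rfl | h1
      exacts [hgp, hgood t h1 h2]
    have hp0' : 0 < p := by
      rcases hp0.eq_or_lt with h | h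
      · rw [← h, Circle.exp_zero, mul_one] at hgp; omega
      · exact h
    have hL : L (y * Circle.exp p) < k := by
      by_contra hL
      push Not at hL
      obtain ⟨q, hq, hq2⟩ := mem_nhdsLT_iff_exists_Ioo_subset.1
        ((hg (y * Circle.exp p)).1.and (Ioo_mem_nhdsLT (neg_lt_zero.2 hp0')))
      have hq' : q < 0 := hq
      have h1 : q / 2 ∈ Set.Ioo q 0 := ⟨by linarith, by linarith⟩
      have h2 : p + q / 2 ∈ S := by
        refine ⟨⟨by linarith [(hq2 h1).2.1], by linarith⟩, fun t h3 h4 => ?_⟩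
        rcases lt_or_ge t p with h5 | h5
        · have h6 := (hq2 (show t - p ∈ Set.Ioo q 0 from ⟨by linarith, by linarith⟩)).1
          rw [hexp, add_sub_cancel] at h6
          rwa [h6]
        · exact hpS t h5 h4
      have := csInf_le hbdd h2
      linarith
    have hR : k ≤ R (y * Circle.exp p) := by
      rw [hmax] at hgp
      rcases le_max_iff.1 hgp with h | h
      · omega
      · exact h
    refine ⟨⟨y * Circle.exp p, hL, hR⟩, ?_⟩
    rw [ConnectedComponents.coe_eq_coe]
    let c : Set.Icc p m → {x : Circle // k ≤ g x} := fun t => ⟨y * Circle.exp t, hpS t t.2.1 t.2.2⟩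
    have hc : Continuous c := by
      refine Continuous.subtype_mk ?_ _
      fun_prop
    have : PreconnectedSpace (Set.Icc p m) := Subtype.preconnectedSpace isPreconnected_Icc
    refine connectedComponent_eq ((isPreconnected_range hc).subset_connectedComponent
      ⟨⟨p, le_rfl, hpm⟩, rfl⟩ ⟨⟨m, hpm, le_rfl⟩, ?_⟩)
    exact Subtype.ext hxm

/-! ### Jumps of arcs and of sums of arcs -/

/-- The clockwise limits of `arc a b`. -/
noncomputable def arcL (a b x : Circle) : ℕ :=
  if 0 < Circle.angleDiff a x ∧ Circle.angleDiff a x ≤ Circle.angleDiff a b then 1 else 0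

/-- The counterclockwise limits of `arc a b`. -/
noncomputable def arcR (a b x : Circle) : ℕ :=
  if Circle.angleDiff a x < Circle.angleDiff a b then 1 else 0

-- The only jumps are one up at `a` and one down at `b`; written additively to avoid subtraction in
-- `ℕ`.
open Classical in
lemma arcR_add {a b : Circle} (hab : a ≠ b) (x : Circle) :
    arcR a b x + (if b = x then 1 else 0) = arcL a b x + if a = x then 1 else 0 := by
  have h1 := Circle.angleDiff_nonneg a x
  have h2 := Circle.angleDiff_pos hab
  have h3 : a = x ↔ Circle.angleDiff a x = 0 := by rw [angleDiff_eq_zero, eq_comm]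
  rw [h3, ← angleDiff_inj (a := a) (x := b), arcR, arcL]
  grind

lemma arc_eq_arcR {a b x : Circle} (hx : b ≠ x) : arc a b x = arcR a b x := by
  rw [Ne, ← angleDiff_inj (a := a)] at hx
  rw [arc, arcR]
  grind

lemma arc_eq_arcL {a b x : Circle} (hx : a ≠ x) : arc a b x = arcL a b x := by
  have h1 := Circle.angleDiff_pos hx
  rw [arc, arcL]
  grind

lemma arc_self_left (a b : Circle) : arc a b a = 1 := by
  rw [arc, if_pos]; rw [angleDiff_self]; exact Circle.angleDiff_nonneg a b

lemma arc_ne_zero (a b : Circle) : arc a b ≠ 0 := fun h => by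
  have := congrFun h a
  rw [arc_self_left] at this
  simp at this

lemma arc_ne_one (a b : Circle) : arc a b ≠ 1 := fun h => by
  have h1 : limPlus (arc a b) b = _ := (hasSides_arc a b b).limPlus_eq
  have h2 : limPlus (arc a b) b = 1 := by rw [h]; exact (HasSides.const 1 b).limPlus_eq
  simp [h1] at h2

lemma arc_inj {a b a' b' : Circle} (hab : a ≠ b) (hab' : a' ≠ b') (h : arc a b = arc a' b') :
    a = a' ∧ b = b' := by
  classical
  have hL : ∀ x, arcL a b x = arcL a' b' x := fun x =>
    (hasSides_arc a b x).limMinus_eq.symm.trans (h ▸ (hasSides_arc a' b' x).limMinus_eq)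
  have hR : ∀ x, arcR a b x = arcR a' b' x := fun x =>
    (hasSides_arc a b x).limPlus_eq.symm.trans (h ▸ (hasSides_arc a' b' x).limPlus_eq)
  constructor
  · have h1 := arcR_add hab a
    have h2 := arcR_add hab' a
    rw [hL, hR, if_neg hab.symm, if_pos rfl] at h1
    by_contra hne
    rw [if_neg (Ne.symm hne)] at h2
    omega
  · have h1 := arcR_add hab b
    have h2 := arcR_add hab' b
    rw [hL, hR, if_neg hab, if_pos rfl] at h1
    by_contra hne
    rw [if_neg (Ne.symm hne)] at h2
    omega

section ArcSystem

variable {ι : Type*} [Fintype ι] {a b : ι → Circle}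

lemma hasSides_sum_arc (a b : ι → Circle) (c : ℕ) (x : Circle) :
    HasSides (fun y => ∑ i, arc (a i) (b i) y + c) x
      (∑ i, arcL (a i) (b i) x + c) (∑ i, arcR (a i) (b i) x + c) := by
  have h := HasSides.sum (s := Finset.univ) fun i (_ : i ∈ Finset.univ) =>
    hasSides_arc (a i) (b i) x
  constructor
  · filter_upwards [h.1] with t ht using congrArg (· + c) ht
  · filter_upwards [h.2] with t ht using congrArg (· + c) ht

/-- No point is both a start and an end, so at `x` either all arcs equal their left values or all
equal their right values. Hence such a sum is its own canonical representative. -/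
lemma sum_arc_eq_max (hab : ∀ i j, a i ≠ b j) (x : Circle) :
    ∑ i, arc (a i) (b i) x = max (∑ i, arcL (a i) (b i) x) (∑ i, arcR (a i) (b i) x) := by
  classical
  by_cases hx : ∃ i, b i = x
  · have hx' : ∀ j, a j ≠ x := fun j => by
      obtain ⟨i, rfl⟩ := hx; exact hab j i
    have h : ∑ i, arcR (a i) (b i) x ≤ ∑ i, arcL (a i) (b i) x :=
      Finset.sum_le_sum fun i _ => by
        have := arcR_add (hab i i) x
        rw [if_neg (hx' i)] at this
        omega
    rw [max_eq_left h]
    exact Finset.sum_congr rfl fun i _ => arc_eq_arcL (hx' i)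
  · push Not at hx
    have h : ∑ i, arcL (a i) (b i) x ≤ ∑ i, arcR (a i) (b i) x :=
      Finset.sum_le_sum fun i _ => by
        have := arcR_add (hab i i) x
        rw [if_neg (hx i)] at this
        omega
    rw [max_eq_right h]
    exact Finset.sum_congr rfl fun i _ => arc_eq_arcR (hx i)

open Classical in
lemma sum_arcR_add (ha : Function.Injective a) (hb : Function.Injective b)
    (hab : ∀ i j, a i ≠ b j) (x : Circle) :
    ∑ i, arcR (a i) (b i) x + (if x ∈ Set.range b then 1 else 0) =
      ∑ i, arcL (a i) (b i) x + if x ∈ Set.range a then 1 else 0 := by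
  have key : ∀ e : ι → Circle, Function.Injective e →
      (if x ∈ Set.range e then 1 else 0) = ∑ i, if e i = x then 1 else 0 := by
    intro e he
    split_ifs with h
    · obtain ⟨i, rfl⟩ := h
      simp [he.eq_iff]
    · rw [Finset.sum_eq_zero]
      intro i _
      rw [if_neg fun hi => h ⟨i, hi⟩]
  rw [key a ha, key b hb, ← Finset.sum_add_distrib, ← Finset.sum_add_distrib]
  exact Finset.sum_congr rfl fun i _ => arcR_add (hab i i) x

end ArcSystem

/-! ### Robust decompositions as systems of arcs -/

/-- A robust decomposition consists of arcs without common endpoints and of full circles. -/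
lemma Robust.exists_arcs {n : ℕ} {v : Fin n → ℂ × ℝ} (hv : Robust v) :
    ∃ (I : Finset (Fin n)) (a b : I → Circle) (c : ℕ), Function.Injective a ∧
      Function.Injective b ∧ (∀ i j, a i ≠ b j) ∧
      (totalSignal v = fun x => ∑ i, arc (a i) (b i) x + c) ∧
      activeSignals v =
        Finset.univ.val.map (fun i => arc (a i) (b i)) + Multiset.replicate c 1 := by
  classical
  set I : Finset (Fin n) := Finset.univ.filter fun i => Proper (v i) with hI
  -- Equality, where the unit circle touches the boundary from inside, may be included: the signal
  -- is still constantly `1`.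
  set J : Finset (Fin n) := Finset.univ.filter fun i => 1 + ‖(v i).1‖ ≤ (v i).2 with hJ
  have hIp : ∀ i : I, Proper (v i) := fun i => (Finset.mem_filter.1 i.2).2
  choose a b hab harc hends using fun i : I => (hIp i).exists_arc
  have hdisj : ∀ i j : I, i ≠ j → ∀ x, x ∈ ends (v i) → x ∉ ends (v j) := fun i j hij x hx hx' =>
    Set.disjoint_left.1 (hv.disjoint_ends (i := i) (j := j) fun h => hij (Subtype.ext h.symm)) hx hx'
  have haE : ∀ i : I, a i ∈ ends (v i) := fun i => by rw [hends]; simp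
  have hbE : ∀ i : I, b i ∈ ends (v i) := fun i => by rw [hends]; simp
  have hJ1 : ∀ i ∈ J, circleSignal (v i) = 1 := fun i hi =>
    circleSignal_eq_one (Finset.mem_filter.1 hi).2
  have hrest : ∀ i, i ∉ I → i ∉ J → circleSignal (v i) = 0 := by
    intro i hi hj
    apply circleSignal_eq_zero
    by_contra h
    have hj' : ¬ (1 + ‖(v i).1‖ ≤ (v i).2) := fun h => hj (Finset.mem_filter.2 ⟨Finset.mem_univ _, h⟩)
    exact hi (Finset.mem_filter.2 ⟨Finset.mem_univ _,
      hv.proper i (not_lt.1 h) (not_le.1 hj')⟩)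
  have hIJ : Disjoint I J := by
    rw [Finset.disjoint_left]
    intro i hi hj
    have h1 := (Finset.mem_filter.1 hi).2.2
    have h2 := (Finset.mem_filter.1 hj).2
    linarith
  have hactive : Finset.univ.filter (fun i => circleSignal (v i) ≠ 0) = I.disjUnion J hIJ := by
    ext i
    simp only [Finset.mem_filter, Finset.mem_univ, true_and, Finset.mem_disjUnion]
    constructor
    · intro h
      by_contra h'
      push Not at h'
      exact h (hrest i h'.1 h'.2)
    · rintro (h | h)
      · rw [harc ⟨i, h⟩]; exact arc_ne_zero _ _
      · rw [hJ1 i h]; exact one_ne_zero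
  refine ⟨I, a, b, J.card, ?_, ?_, ?_, ?_, ?_⟩
  · intro i j hij
    by_contra hne
    exact hdisj i j hne _ (haE i) (hij ▸ haE j)
  · intro i j hij
    by_contra hne
    exact hdisj i j hne _ (hbE i) (hij ▸ hbE j)
  · intro i j hij
    by_cases hne : i = j
    · exact hab i (by rw [hij, hne])
    · exact hdisj i j hne _ (haE i) (hij ▸ hbE j)
  · funext x
    have h1 : totalSignal v x = ∑ i ∈ I.disjUnion J hIJ, circleSignal (v i) x := by
      rw [← hactive, totalSignal]
      refine (Finset.sum_filter_of_ne (p := fun i => circleSignal (v i) ≠ 0) ?_).symm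
      intro i _ h h0
      rw [h0] at h
      exact h rfl
    rw [h1, Finset.sum_disjUnion, ← Finset.sum_coe_sort I]
    congr 1
    · exact Finset.sum_congr rfl fun i _ => by rw [harc]
    · rw [Finset.sum_congr rfl fun i hi => by rw [hJ1 i hi]]
      simp
  · have h1 : activeSignals v = (I.disjUnion J hIJ).val.map fun i => circleSignal (v i) := by
      rw [← hactive, activeSignals, Multiset.filter_map]; rfl
    rw [h1, Finset.disjUnion_val, Multiset.map_add]
    congr 1
    · have h2 : (Finset.univ : Finset I).val.map (fun i => arc (a i) (b i)) =
          (Finset.univ : Finset I).val.map (fun i : I => circleSignal (v i)) :=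
        Multiset.map_congr rfl fun i _ => (harc i).symm
      rw [h2, Finset.univ_eq_attach, Finset.attach_val]
      exact (Multiset.attach_map_val' I.val fun i => circleSignal (v i)).symm
    · rw [Multiset.map_congr rfl hJ1, Multiset.map_const']; rfl

/-- Arcs without common endpoints, together with full circles, form a robust decomposition. -/
lemma exists_robust_of_arcs {ι : Type*} [Fintype ι] {a b : ι → Circle} (c : ℕ)
    (ha : Function.Injective a) (hb : Function.Injective b) (hab : ∀ i j, a i ≠ b j) :
    ∃ (n : ℕ) (v : Fin n → ℂ × ℝ), Robust v ∧
      (totalSignal v = fun x => ∑ i, arc (a i) (b i) x + c) ∧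
      activeSignals v =
        Finset.univ.val.map (fun i => arc (a i) (b i)) + Multiset.replicate c 1 := by
  classical
  choose p hp hpa using fun i => exists_proper_of_ne (hab i i)
  -- The disk of radius `2` about the origin serves as a stable full circle.
  have h02 : 1 + ‖((0 : ℂ), (2 : ℝ)).1‖ < ((0 : ℂ), (2 : ℝ)).2 := by norm_num
  let w : ι ⊕ Fin c → ℂ × ℝ := Sum.elim p fun _ => (0, 2)
  let e : Fin (Fintype.card (ι ⊕ Fin c)) ≃ ι ⊕ Fin c := (Fintype.equivFin _).symm
  have hw1 : ∀ i, circleSignal (w (Sum.inl i)) = arc (a i) (b i) := hpa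
  have hw2 : ∀ i, circleSignal (w (Sum.inr i)) = 1 := fun i => circleSignal_eq_one h02.le
  have hends : ∀ i, ends (p i) = {a i, b i} := by
    intro i; ext x; rw [ends, hpa]; exact not_continuousAt_arc_iff (hab i i)
  have hdisj : ∀ i j, j ≠ i → Disjoint (ends (w i)) (ends (w j)) := by
    rintro (i | i) (j | j) hij
    · change Disjoint (ends (p i)) (ends (p j))
      have hij' : j ≠ i := fun h => hij (by rw [h])
      rw [hends, hends, Set.disjoint_left]
      rintro x (rfl | rfl) (h | h)
      · exact hij' (ha h).symm
      · exact hab i j h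
      · exact hab j i h.symm
      · exact hij' (hb h).symm
    · exact (ends_eq_empty (p := w (Sum.inr j)) (Or.inl h02.le)) ▸ Set.disjoint_empty _
    · exact (ends_eq_empty (p := w (Sum.inr i)) (Or.inl h02.le)) ▸ Set.empty_disjoint _
    · exact (ends_eq_empty (p := w (Sum.inr i)) (Or.inl h02.le)) ▸ Set.empty_disjoint _
  have hst : ∀ i, Stable (w i) := by
    rintro (i | i)
    exacts [Or.inl (hp i), Or.inr h02]
  refine ⟨_, w ∘ e, robust_of_stable (fun i => hst _)
    (fun i j hij => hdisj _ _ fun h => hij (e.injective h)), ?_, ?_⟩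
  · funext x
    rw [totalSignal]
    simp only [Function.comp_apply]
    rw [e.sum_comp fun i => circleSignal (w i) x, Fintype.sum_sum_type]
    simp [hw1, hw2]
  · have h1 : (Finset.univ.val.map fun i => circleSignal ((w ∘ e) i)) =
        Finset.univ.val.map (fun i => arc (a i) (b i)) + Multiset.replicate c 1 := by
      have h2 : (Finset.univ : Finset (ι ⊕ Fin c)).val = Finset.univ.val.map e := by
        rw [← Finset.map_univ_equiv e]; rfl
      have h3 : (Finset.univ : Finset (ι ⊕ Fin c)).val.map (fun i => circleSignal (w i)) =
          Finset.univ.val.map (fun i => arc (a i) (b i)) + Multiset.replicate c 1 := by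
        rw [← Finset.univ_disjSum_univ, Finset.val_disjSum, Multiset.disjSum, Multiset.map_add,
          Multiset.map_map, Multiset.map_map]
        simp [hw1, hw2]
      rw [← h3, h2, Multiset.map_map]; rfl
    rw [activeSignals, h1, Multiset.filter_eq_self]
    intro g hg
    rcases Multiset.mem_add.1 hg with hg | hg
    · obtain ⟨i, -, rfl⟩ := Multiset.mem_map.1 hg
      exact arc_ne_zero _ _
    · rw [Multiset.eq_of_mem_replicate hg]; exact one_ne_zero

/-! ### Jumps of the given function -/

/-- The points at which a function jumps up, counterclockwise. -/
def upJumps (f : Circle → ℕ) : Set Circle := {x | limMinus f x < limPlus f x}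

/-- The points at which a function jumps down, counterclockwise. -/
def downJumps (f : Circle → ℕ) : Set Circle := {x | limPlus f x < limMinus f x}

section

variable {ι : Type*} [Fintype ι] {a b : ι → Circle} {c : ℕ} {f : Circle → ℕ}

lemma hasSides_of_modFinite (hf : (fun x => ∑ i, arc (a i) (b i) x + c) ∈ modFinite f)
    (x : Circle) :
    HasSides f x (∑ i, arcL (a i) (b i) x + c) (∑ i, arcR (a i) (b i) x + c) :=
  (hasSides_sum_arc a b c x).of_finite_ne hf

lemma canon_eq (hab : ∀ i j, a i ≠ b j)
    (hf : (fun x => ∑ i, arc (a i) (b i) x + c) ∈ modFinite f) (x : Circle) :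
    canon f x = ∑ i, arc (a i) (b i) x + c := by
  rw [canon, (hasSides_of_modFinite hf x).limPlus_eq, (hasSides_of_modFinite hf x).limMinus_eq,
    sum_arc_eq_max hab, max_comm, max_add_add_right]

lemma jump_eq (ha : Function.Injective a) (hb : Function.Injective b) (hab : ∀ i j, a i ≠ b j)
    (hf : (fun x => ∑ i, arc (a i) (b i) x + c) ∈ modFinite f) (x : Circle) :
    (x ∈ Set.range a → limPlus f x = limMinus f x + 1) ∧
    (x ∈ Set.range b → limMinus f x = limPlus f x + 1) ∧
    (x ∉ Set.range a → x ∉ Set.range b → limPlus f x = limMinus f x) := by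
  classical
  have h := sum_arcR_add ha hb hab x
  rw [(hasSides_of_modFinite hf x).limPlus_eq, (hasSides_of_modFinite hf x).limMinus_eq]
  have hd : x ∈ Set.range a → x ∉ Set.range b := by
    rintro ⟨i, rfl⟩ ⟨j, hj⟩
    exact hab i j hj.symm
  refine ⟨fun h1 => ?_, fun h1 => ?_, fun h1 h2 => ?_⟩
  · rw [if_neg (hd h1), if_pos h1] at h; omega
  · rw [if_neg (fun h2 => hd h2 h1), if_pos h1] at h; omega
  · rw [if_neg h1, if_neg h2] at h; omega

lemma upJumps_eq (ha : Function.Injective a) (hb : Function.Injective b) (hab : ∀ i j, a i ≠ b j)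
    (hf : (fun x => ∑ i, arc (a i) (b i) x + c) ∈ modFinite f) : upJumps f = Set.range a := by
  ext x
  obtain ⟨h1, h2, h3⟩ := jump_eq ha hb hab hf x
  rw [upJumps, Set.mem_ofPred_eq]
  by_cases hx : x ∈ Set.range a
  · simp [hx, h1 hx]
  · by_cases hx' : x ∈ Set.range b
    · simp only [hx, iff_false, h2 hx']; omega
    · simp only [hx, iff_false, h3 hx hx']; omega

lemma downJumps_eq (ha : Function.Injective a) (hb : Function.Injective b) (hab : ∀ i j, a i ≠ b j)
    (hf : (fun x => ∑ i, arc (a i) (b i) x + c) ∈ modFinite f) : downJumps f = Set.range b := by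
  ext x
  obtain ⟨h1, h2, h3⟩ := jump_eq ha hb hab hf x
  rw [downJumps, Set.mem_ofPred_eq]
  by_cases hx' : x ∈ Set.range b
  · simp [hx', h2 hx']
  · by_cases hx : x ∈ Set.range a
    · simp only [hx', iff_false, h1 hx]; omega
    · simp only [hx', iff_false, h3 hx hx']; omega

end

/-- By `arc_add` an arc is a term in its start and `x`, minus a term in its end and `x`, plus a
constant. Summed over a bijection, the parts depending on `x` no longer see the matching. -/
lemma sum_arc_add_sum_arc {α β : Type*} [Fintype α] [Fintype β] (a : α → Circle) (b : β → Circle)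
    (σ τ : α ≃ β) (x y : Circle) :
    ∑ i, arc (a i) (b (σ i)) x + ∑ i, arc (a i) (b (τ i)) y =
      ∑ i, arc (a i) (b (τ i)) x + ∑ i, arc (a i) (b (σ i)) y := by
  have key : ∀ (σ : α ≃ β) (x : Circle), ∑ i, arc (a i) (b (σ i)) x +
      ∑ j, (if Circle.angleDiff 1 (b j) < Circle.angleDiff 1 x then 1 else 0) =
      ∑ i, (if Circle.angleDiff 1 (a i) ≤ Circle.angleDiff 1 x then 1 else 0) +
      ∑ i, (if Circle.angleDiff 1 (b (σ i)) < Circle.angleDiff 1 (a i) then 1 else 0) := by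
    intro σ x
    rw [← σ.sum_comp fun j => if Circle.angleDiff 1 (b j) < Circle.angleDiff 1 x then 1 else 0,
      ← Finset.sum_add_distrib, ← Finset.sum_add_distrib]
    exact Finset.sum_congr rfl fun i _ => arc_add 1 (a i) (b (σ i)) x
  have h1 := key σ x
  have h2 := key σ y
  have h3 := key τ x
  have h4 := key τ y
  omega

section Extrema

variable {f : Circle → ℕ}

lemma exists_canon_eq_lower (f : Circle → ℕ) :
    (∃ x, canon f x = lower f) ∧ ∀ x, lower f ≤ canon f x :=
  ⟨Nat.sInf_mem (Set.range_nonempty _), fun x => Nat.sInf_le ⟨x, rfl⟩⟩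

lemma exists_canon_eq_upper {N : ℕ} (h : ∀ x, canon f x ≤ N) :
    (∃ x, canon f x = upper f) ∧ ∀ x, canon f x ≤ upper f := by
  have hb : BddAbove (Set.range (canon f)) := ⟨N, by rintro _ ⟨x, rfl⟩; exact h x⟩
  exact ⟨Nat.sSup_mem (Set.range_nonempty _) hb, fun x => le_csSup hb ⟨x, rfl⟩⟩

end Extrema

/-! ### Counting the upward jumps -/

/-- The number of upward jumps is determined by the extrema and the component counts. -/
lemma ncard_upJumps_add_lower {f : Circle → ℕ} {ι : Type*} [Fintype ι] {a b : ι → Circle} {c : ℕ}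
    (ha : Function.Injective a) (hb : Function.Injective b) (hab : ∀ i j, a i ≠ b j)
    (hf : (fun x => ∑ i, arc (a i) (b i) x + c) ∈ modFinite f) :
    (upJumps f).ncard = upper f - lower f + tau f := by
  classical
  have hup := upJumps_eq ha hb hab hf
  have hfin : (upJumps f).Finite := hup ▸ Set.finite_range a
  have hcanon := canon_eq hab hf
  have hbound : ∀ x, canon f x ≤ Fintype.card ι + c := fun x => by
    rw [hcanon]
    gcongr
    simpa using Finset.sum_le_card_nsmul Finset.univ _ 1 fun i _ => arc_le_one (a i) (b i) x
  obtain ⟨⟨y₀, hy₀⟩, hlow⟩ := exists_canon_eq_lower f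
  obtain ⟨⟨y₁, hy₁⟩, hupp⟩ := exists_canon_eq_upper hbound
  have hsides : ∀ x, HasSides (canon f) x (limMinus f x) (limPlus f x) := by
    intro x
    rw [funext hcanon, (hasSides_of_modFinite hf x).limPlus_eq,
      (hasSides_of_modFinite hf x).limMinus_eq]
    exact hasSides_sum_arc a b c x
  have hmax : ∀ x, canon f x = max (limMinus f x) (limPlus f x) := fun x => max_comm _ _
  have hjump : ∀ x ∈ upJumps f, limPlus f x = limMinus f x + 1 := fun x hx =>
    (jump_eq ha hb hab hf x).1 (hup ▸ hx)
  have hL : ∀ x, lower f ≤ limMinus f x := by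
    intro x
    obtain ⟨t, ht⟩ := (hsides x).1.exists
    exact ht ▸ hlow _
  have hR : ∀ x, limPlus f x ≤ upper f := fun x => (le_max_left _ _).trans (hupp x)
  -- A jump of height one crosses exactly one level, namely its right limit.
  have hlevel : ∀ k, {x | limMinus f x < k ∧ k ≤ limPlus f x} =
      ↑(hfin.toFinset.filter fun x => limPlus f x = k) := by
    intro k
    ext x
    simp only [Set.mem_ofPred_eq, Finset.coe_filter, Set.Finite.mem_toFinset]
    constructor
    · rintro ⟨h1, h2⟩
      have hx : x ∈ upJumps f := h1.trans_le h2
      have := hjump x hx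
      exact ⟨hx, by omega⟩
    · rintro ⟨h1, h2⟩
      have := hjump x h1
      omega
  have hcount : ∀ k ∈ Finset.Icc (lower f + 1) (upper f),
      (hfin.toFinset.filter fun x => limPlus f x = k).card =
        (Nat.card (ConnectedComponents {x : Circle // k ≤ canon f x}) - 1) + 1 := by
    intro k hk
    rw [Finset.mem_Icc] at hk
    obtain ⟨e⟩ := nonempty_equiv_components_superlevel hsides hmax (k := k) (y := y₀) (by omega)
    rw [hlevel] at e
    have : Nat.card (ConnectedComponents {x : Circle // k ≤ canon f x}) =
        (hfin.toFinset.filter fun x => limPlus f x = k).card := by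
      rw [← Nat.card_congr e, Nat.card_coe_set_eq, Set.ncard_coe_finset]
    -- The maximum is attained at `y₁`, so there is a component at every level up to `upper f` and
    -- the truncated `- 1` in `tau` is exact.
    have hne : Nonempty (ConnectedComponents {x : Circle // k ≤ canon f x}) :=
      ⟨ConnectedComponents.mk ⟨y₁, by omega⟩⟩
    have hfinite : Finite (ConnectedComponents {x : Circle // k ≤ canon f x}) :=
      Finite.of_equiv _ e
    have := Nat.card_pos (α := ConnectedComponents {x : Circle // k ≤ canon f x})
    omega
  rw [Set.ncard_eq_toFinset_card _ hfin, Finset.card_eq_sum_card_fiberwise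
    (f := limPlus f) (t := Finset.Icc (lower f + 1) (upper f)), Finset.sum_congr rfl hcount,
    Finset.sum_add_distrib, tau]
  · simp [add_comm]
  · intro x hx
    have hx' : x ∈ upJumps f := by simpa using hx
    have := hjump x hx'
    have := hL x
    have := hR x
    rw [Finset.coe_Icc, Set.mem_Icc]
    omega

/-! ### Matchings of upward and downward jumps -/

/-- The multiset formed by the arcs of a matching of the upward with the downward jumps, and by
`c` full circles. -/
noncomputable def matchingSignals {f : Circle → ℕ} [Fintype (upJumps f)]
    (σ : upJumps f ≃ downJumps f) (c : ℕ) : Multiset (Circle → ℕ) :=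
  Finset.univ.val.map (fun x : upJumps f => arc x (σ x)) + Multiset.replicate c 1

lemma ne_of_mem_jumps {f : Circle → ℕ} (x : upJumps f) (y : downJumps f) : (x : Circle) ≠ y :=
  fun h => by
    have h1 : limMinus f x < limPlus f x := x.2
    have h2 : limPlus f y < limMinus f y := y.2
    rw [h] at h1
    exact lt_asymm h1 h2

/-- An arc is never a full circle, and it determines its endpoints; so the partner of each upward
jump can be read off from the multiset. -/
lemma matchingSignals_injective {f : Circle → ℕ} [Fintype (upJumps f)]
    {σ σ' : upJumps f ≃ downJumps f} {c c' : ℕ}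
    (h : matchingSignals σ c = matchingSignals σ' c') : σ = σ' := by
  ext x
  have hx : arc x (σ x) ∈ matchingSignals σ c :=
    Multiset.mem_add.2 (Or.inl (Multiset.mem_map.2 ⟨x, Finset.mem_univ _, rfl⟩))
  rw [h] at hx
  rcases Multiset.mem_add.1 hx with hx | hx
  · obtain ⟨y, -, hy⟩ := Multiset.mem_map.1 hx
    obtain ⟨h1, h2⟩ := arc_inj (ne_of_mem_jumps _ _) (ne_of_mem_jumps _ _) hy
    rw [← h2, Subtype.ext h1]
  · exact absurd (Multiset.eq_of_mem_replicate hx) (arc_ne_one _ _)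

lemma Robust.exists_matching {f : Circle → ℕ} [Fintype (upJumps f)] {n : ℕ} {v : Fin n → ℂ × ℝ}
    (hv : Robust v) (hf : totalSignal v ∈ modFinite f) :
    ∃ (σ : upJumps f ≃ downJumps f) (c : ℕ),
      (totalSignal v = fun x => ∑ i : upJumps f, arc i (σ i) x + c) ∧
      activeSignals v = matchingSignals σ c := by
  classical
  obtain ⟨I, a, b, c, ha, hb, hab, htot, hact⟩ := hv.exists_arcs
  rw [htot] at hf
  let eA : I ≃ upJumps f :=
    (Equiv.ofInjective a ha).trans (Equiv.setCongr (upJumps_eq ha hb hab hf).symm)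
  let eB : I ≃ downJumps f :=
    (Equiv.ofInjective b hb).trans (Equiv.setCongr (downJumps_eq ha hb hab hf).symm)
  have hA : ∀ i, ((eA i : upJumps f) : Circle) = a i := fun i => rfl
  have hB : ∀ i, ((eB i : downJumps f) : Circle) = b i := fun i => rfl
  refine ⟨eA.symm.trans eB, c, ?_, ?_⟩
  · rw [htot]
    funext x
    rw [← eA.sum_comp]
    simp [hA, hB]
  · rw [hact, matchingSignals]
    congr 1
    have h2 : (Finset.univ : Finset (upJumps f)).val = Finset.univ.val.map eA := by
      rw [← Finset.map_univ_equiv eA]; rfl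
    rw [h2, Multiset.map_map]
    simp [hA, hB]

end CircleDecomp

open CircleDecomp

/-! ### The number of robust decompositions -/

theorem proposition6p3 (f : Circle → ℕ) (hf : CircleDecomp.PiecewiseConst f)
    (hex : ∃ (n : ℕ) (v : Fin n → ℂ × ℝ),
      CircleDecomp.totalSignal v ∈ CircleDecomp.modFinite f ∧ CircleDecomp.Robust v)
    (hτ : CircleDecomp.tau f ≤ CircleDecomp.lower f) :
    (CircleDecomp.robustDecomps f).ncard =
      Nat.factorial (CircleDecomp.upper f - CircleDecomp.lower f + CircleDecomp.tau f) := by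
  classical
  obtain ⟨n, v, hvf, hv⟩ := hex
  obtain ⟨I, a, b, c, ha, hb, hab, htot, -⟩ := hv.exists_arcs
  have hvf' := htot ▸ hvf
  have hcard := ncard_upJumps_add_lower ha hb hab hvf'
  have hfin : (upJumps f).Finite := upJumps_eq ha hb hab hvf' ▸ Set.finite_range a
  have : Fintype (upJumps f) := hfin.fintype
  obtain ⟨σ₀, c₀, htot₀, -⟩ := hv.exists_matching hvf
  have : Fintype (downJumps f) := Fintype.ofEquiv _ σ₀
  rw [← Nat.card_coe_set_eq, Nat.card_eq_fintype_card] at hcard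
  have hsum_le : ∀ (σ : upJumps f ≃ downJumps f) x,
      ∑ i : upJumps f, arc i (σ i) x ≤ Fintype.card (upJumps f) := fun σ x => by
    simpa using Finset.sum_le_card_nsmul Finset.univ _ 1
      fun (i : upJumps f) _ => arc_le_one i (σ i) x
  have hcanon : ∀ (σ : upJumps f ≃ downJumps f) (c : ℕ),
      (fun x => ∑ i : upJumps f, arc i (σ i) x + c) ∈ modFinite f →
        ∀ x, canon f x = ∑ i : upJumps f, arc i (σ i) x + c := fun σ c h =>
    canon_eq (a := fun i : upJumps f => (i : Circle)) (b := fun i => (σ i : Circle))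
      (fun i j => ne_of_mem_jumps _ _) h
  have hg := hcanon σ₀ c₀ (htot₀ ▸ hvf)
  obtain ⟨⟨x₀, hx₀⟩, hlow⟩ := exists_canon_eq_lower f
  obtain ⟨⟨x₁, hx₁⟩, hupp⟩ := exists_canon_eq_upper (f := f)
    (N := Fintype.card (upJumps f) + c₀) fun x => by rw [hg]; gcongr; exact hsum_le _ _
  have hle : lower f ≤ upper f := hx₀ ▸ hupp x₀
  have hswap : ∀ (σ : upJumps f ≃ downJumps f) x,
      ∑ i : upJumps f, arc i (σ i) x + ∑ i : upJumps f, arc i (σ₀ i) x₀ =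
        ∑ i : upJumps f, arc i (σ₀ i) x + ∑ i : upJumps f, arc i (σ i) x₀ := fun σ x =>
    sum_arc_add_sum_arc (fun i : upJumps f => (i : Circle)) (fun j : downJumps f => (j : Circle))
      σ σ₀ x x₀
  -- By `hswap` the arcs of `σ` also rise by `upper f - lower f` from `x₀` to `x₁`, where they sum
  -- to at most `upper f - lower f + tau f`. So at `x₀` they sum to at most `tau f`, and `hτ`
  -- applies.
  have hbase : ∀ σ : upJumps f ≃ downJumps f, ∑ i : upJumps f, arc i (σ i) x₀ ≤ lower f := by
    intro σ
    have h1 := hswap σ x₁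
    have h2 := hsum_le σ x₁
    have h3 := hg x₀
    have h4 := hg x₁
    omega
  have htotal : ∀ (σ : upJumps f ≃ downJumps f) x, ∑ i : upJumps f, arc i (σ i) x +
      (lower f - ∑ i : upJumps f, arc i (σ i) x₀) = totalSignal v x := by
    intro σ x
    have h1 := hswap σ x
    have h2 := hbase σ
    have h3 := hg x₀
    rw [htot₀]
    dsimp only
    omega
  have hrange : robustDecomps f = Set.range fun σ : upJumps f ≃ downJumps f =>
      matchingSignals σ (lower f - ∑ i : upJumps f, arc i (σ i) x₀) := by
    ext M
    constructor
    · rintro ⟨m, w, hwf, hw, rfl⟩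
      obtain ⟨σ, c', htot', hact'⟩ := hw.exists_matching hwf
      refine ⟨σ, ?_⟩
      rw [hact']
      -- The canonical value `lower f` at `x₀` fixes the number of full circles.
      have h1 := hcanon σ c' (htot' ▸ hwf) x₀
      dsimp only
      congr 1
      omega
    · rintro ⟨σ, rfl⟩
      obtain ⟨m, w, hw, htot', hact'⟩ := exists_robust_of_arcs
        (a := fun i : upJumps f => (i : Circle)) (b := fun i => (σ i : Circle))
        (lower f - ∑ i : upJumps f, arc i (σ i) x₀) Subtype.val_injective
        (Subtype.val_injective.comp σ.injective) (fun i j => ne_of_mem_jumps _ _)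
      refine ⟨m, w, ?_, hw, hact'⟩
      rw [htot', funext (htotal σ)]
      exact hvf
  rw [hrange, ← Nat.card_coe_set_eq, Nat.card_range_of_injective
    fun σ σ' h => matchingSignals_injective h, Nat.card_eq_fintype_card,
    Fintype.card_equiv σ₀, hcard]
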